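/- Let $\Bbbk$ be a commutative ring (for example $\mathbb Z$ or a field of any characteristic) and let $n\ge 0$. **Notation.** Let $R_n=\Bbbk[x_1,\dots,x_n]\otimes\bigwedge(\omega_1,\dots,\omega_n)$, a $\mathbb Z^2$-graded superalgebra with $x_i$ even, $\omega_i$ odd, $\deg x_i=(2,0)$ and $\deg\omega_i=(-2i,2)$. The symmetric group $\mathfrak S_n$ acts on $R_n$ by algebra automorphisms: the simple transposition $s_j$ exchanges $x_j$ and $x_{j+1}$, fixes the other $x_i$, and sends $\omega_i$ to $\omega_i+\delta_{i,j}(x_j-x_{j+1})\omega_{j+1}$. The enhanced nilHecke algebra is $A_n=\operatorname{End}_{R_n^{\mathfrak S_n}}(R_n)$, the algebra of all $\Bbbk$-linear $\xi:R_n\to R_n$ with $\xi(fr)=\xi(f)r$ for all $f\in R_n$ and $r\in R_n^{\mathfrak S_n}$, graded by the bidegree of endomorphisms. The algebra $R_n$ is a subalgebra of $A_n$, acting by left multiplication, and $T_j\in A_n$ $(1\le j\le n-1)$ is the operator $T_j(f)=\dfrac{f-s_j(f)}{x_j-x_{j+1}}$. Let $\mathrm d_n$ be the derivation of $R_n$ with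 $\mathrm d_n(x_i)=x_i^2$ and $$\mathrm d_n(\omega_i)=\sum_{j=i+1}^{n}\alpha_{i,j}\,\omega_j,\qquad \alpha_{i,j}=\sum_{l=j}^n x_l^2\prod_{k=i+1}^{j-1}(x_k-x_l).$$ For $a\in\Bbbk$ let $\mathrm d_a$ be the derivation of $A_n$ given by $\mathrm d_a(\xi)=D\circ\xi-\xi\circ D$, where $D(f)=\mathrm d_n(f)+f\sum_{i=1}^n c_ix_i$ for any $c_1,\dots,c_n\in\Bbbk$ with $c_{i+1}-c_i=a$ for all $1\le i<n$ (it does not depend on the choice of the $c_i$). **Statement.** 1. There is an algebra homomorphism $\phi'_n:R_n\to R_{n+1}$ with, for $1\le i\le n$, $$\phi'_n(x_i)=x_i,\qquad \phi'_n(\omega_i)=\omega_i-\sum_{l=i+1}^{n+1}x_{n+1}\prod_{j=i+1}^{l-1}(x_j-x_{n+1})\,\omega_l$$ (an empty product is $1$). It preserves the gradings, and $\phi'_n\circ\mathrm d_n=\mathrm d_{n+1}\circ\phi'_n$. 2. There is an algebra homomorphism $\phi_n:A_n\to A_{n+1}$ with $$\phi_n(x_i)=x_i,\qquad \phi_n(\omega_i)=\omega_i-\sum_{l=i+1}^{n+1}x_{n+1}\prod_{j=i+1}^{l-1}(x_j-x_{n+1})\,\omega_l\quad(1\le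 i\le n),\qquad \phi_n(T_j)=T_j\quad(1\le j\le n-1).$$ It is injective, preserves the gradings, and satisfies $\phi_n\circ\mathrm d_a=\mathrm d_a\circ\phi_n$ for every $a\in\Bbbk$, where $\mathrm d_a$ is the derivation of $A_n$ on the left-hand side and that of $A_{n+1}$ on the right-hand side. 3. The restriction of $\phi_n$ to $R_n\subseteq A_n$ is $\phi'_n$; that is, $\phi_n(f)=\phi'_n(f)$ for every $f\in R_n$. -/

import Mathlib

open scoped TensorProduct

namespace EnhancedNilHecke

noncomputable section

universe u v

/-! ### The ring of extended polynomials

Indices run over `Fin n`, so that `i : Fin n` stands for the index `i + 1` of the `n` variables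
`x_1, …, x_n` and `ω_1, …, ω_n`. -/

/-- The polynomial ring `k[x_1, …, x_n]`. -/
abbrev Pol (k : Type u) [CommRing k] (n : ℕ) : Type u := MvPolynomial (Fin n) k

/-- The ring of extended polynomials `R_n = k[x_1, …, x_n] ⊗ ⋀(ω_1, …, ω_n)`. -/
def R (k : Type u) [CommRing k] (n : ℕ) : Type u :=
  Pol k n ⊗[k] ExteriorAlgebra k (Fin n → k)

instance (k : Type u) [CommRing k] (n : ℕ) : Ring (R k n) :=
  inferInstanceAs (Ring (Pol k n ⊗[k] ExteriorAlgebra k (Fin n → k)))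

instance (k : Type u) [CommRing k] (n : ℕ) : Algebra k (R k n) :=
  inferInstanceAs (Algebra k (Pol k n ⊗[k] ExteriorAlgebra k (Fin n → k)))

variable {k : Type u} [CommRing k] {n : ℕ}

/-- The inclusion `k[x_1, …, x_n] → R_n`. -/
def pol : Pol k n →ₐ[k] R k n :=
  (Algebra.TensorProduct.includeLeft :
    Pol k n →ₐ[k] Pol k n ⊗[k] ExteriorAlgebra k (Fin n → k))

/-- The inclusion `⋀(ω_1, …, ω_n) → R_n`. -/
def ext : ExteriorAlgebra k (Fin n → k) →ₐ[k] R k n :=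
  (Algebra.TensorProduct.includeRight :
    ExteriorAlgebra k (Fin n → k) →ₐ[k] Pol k n ⊗[k] ExteriorAlgebra k (Fin n → k))

/-- The even generators `x_i` of `R_n`. -/
def x (i : Fin n) : R k n := pol (MvPolynomial.X i)

/-- The odd generators `ω_i` of `R_n`. -/
def ω (i : Fin n) : R k n := ext (ExteriorAlgebra.ι k (Pi.single i 1))

theorem pol_mul_ext (p : Pol k n) (y : ExteriorAlgebra k (Fin n → k)) :
    (pol p * ext y : R k n) = (p ⊗ₜ[k] y : Pol k n ⊗[k] ExteriorAlgebra k (Fin n → k)) :=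
  (Algebra.TensorProduct.tmul_mul_tmul p 1 1 y).trans (by rw [mul_one, one_mul])

theorem ext_mul_pol (p : Pol k n) (y : ExteriorAlgebra k (Fin n → k)) :
    (ext y * pol p : R k n) = pol p * ext y :=
  ((Algebra.TensorProduct.tmul_mul_tmul 1 p y 1).trans (by rw [mul_one, one_mul])).trans
    (pol_mul_ext p y).symm

theorem tensor_induction {P : R k n → Prop} (h0 : P 0)
    (hadd : ∀ f g, P f → P g → P (f + g))
    (hmul : ∀ (p : Pol k n) (y : ExteriorAlgebra k (Fin n → k)), P (pol p * ext y))
    (f : R k n) : P f := by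
  refine TensorProduct.induction_on (motive := P) f h0 (fun p y => ?_) hadd
  rw [← pol_mul_ext]
  exact hmul p y

theorem pol_comm (p : Pol k n) (f : R k n) : pol p * f = f * pol p := by
  induction f using tensor_induction with
  | h0 => simp
  | hadd f g hf hg => rw [mul_add, add_mul, hf, hg]
  | hmul q y =>
    rw [← mul_assoc, ← map_mul, mul_comm p q, map_mul, mul_assoc, mul_assoc, ext_mul_pol]

theorem ω_sq (i : Fin n) : (ω i * ω i : R k n) = 0 := by
  rw [ω, ← map_mul, ExteriorAlgebra.ι_sq_zero, map_zero]

theorem ω_anticomm (i j : Fin n) : (ω i * ω j + ω j * ω i : R k n) = 0 := by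
  have h := congrArg (ext (k := k) (n := n))
    (ExteriorAlgebra.ι_add_mul_swap (R := k) (Pi.single i 1) (Pi.single j 1))
  simpa only [map_add, map_mul, map_zero, ω] using h

/-- Properties that hold for the generators and are stable under the algebra operations hold on
all of `R_n`. -/
theorem gen_induction {P : R k n → Prop} (hc : ∀ c : k, P (algebraMap k _ c))
    (hx : ∀ i, P (x i)) (hω : ∀ i, P (ω i))
    (hadd : ∀ f g, P f → P g → P (f + g)) (hmul : ∀ f g, P f → P g → P (f * g))
    (f : R k n) : P f := by
  have hsmul : ∀ (c : k) f, P f → P (c • f) := fun c f hf => by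
    rw [Algebra.smul_def]; exact hmul _ _ (hc c) hf
  have h0 : P 0 := by simpa using hc 0
  induction f using tensor_induction with
  | h0 => exact h0
  | hadd f g hf hg => exact hadd f g hf hg
  | hmul p y =>
    refine hmul _ _ ?_ ?_
    · induction p using MvPolynomial.induction_on with
      | C c => exact (pol.commutes c : pol (MvPolynomial.C c) = algebraMap k (R k n) c) ▸ hc c
      | add p q hp hq => rw [map_add]; exact hadd _ _ hp hq
      | mul_X p i hp => rw [map_mul]; exact hmul _ _ hp (hx i)
    · induction y using ExteriorAlgebra.induction with
      | algebraMap c => rw [AlgHom.commutes]; exact hc c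
      | add a b ha hb => rw [map_add]; exact hadd _ _ ha hb
      | mul a b ha hb => rw [map_mul]; exact hmul _ _ ha hb
      | ι m =>
        rw [pi_eq_sum_univ' m, map_sum, map_sum]
        refine Finset.sum_induction _ P hadd h0 fun i _ => ?_
        rw [map_smul, map_smul]
        exact hsmul _ _ (hω i)

theorem exterior_hom_cond {B : Type v} [Ring B] [Algebra k B] (b : Fin n → B)
    (hb : ∀ i, b i * b i = 0) (hb' : ∀ i j, b i * b j + b j * b i = 0) (c : Fin n → k) :
    Fintype.linearCombination k b c * Fintype.linearCombination k b c = 0 := by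
  have key : ∀ s : Finset (Fin n), (∑ i ∈ s, c i • b i) * (∑ i ∈ s, c i • b i) = 0 := by
    intro s
    induction s using Finset.induction_on with
    | empty => simp
    | insert a s ha ih =>
      rw [Finset.sum_insert ha, add_mul, mul_add, mul_add, ih, add_zero, smul_mul_smul_comm,
        hb, smul_zero, zero_add, Finset.mul_sum, Finset.sum_mul, ← Finset.sum_add_distrib]
      refine Finset.sum_eq_zero fun i _ => ?_
      rw [smul_mul_smul_comm, smul_mul_smul_comm, mul_comm (c i), ← smul_add, hb', smul_zero]
  exact key Finset.univ

/-- The universal property of `R_n`: an algebra map out of `R_n` is given by central images of the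
`x_i` and anticommuting images of square zero of the `ω_i`. -/
def lift {B : Type v} [Ring B] [Algebra k B] (a b : Fin n → B)
    (ha : ∀ i y, a i * y = y * a i)
    (hb : ∀ i, b i * b i = 0) (hb' : ∀ i j, b i * b j + b j * b i = 0) : R k n →ₐ[k] B :=
  (Algebra.TensorProduct.lift
    ((Subalgebra.center k B).val.comp (MvPolynomial.aeval
      (fun i => (⟨a i, Subalgebra.mem_center_iff.mpr fun y => (ha i y).symm⟩ :
        Subalgebra.center k B))))
    (ExteriorAlgebra.lift k ⟨Fintype.linearCombination k b, exterior_hom_cond b hb hb'⟩)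
    (fun p _ => (Subalgebra.mem_center_iff.mp (MvPolynomial.aeval
      (fun i => (⟨a i, Subalgebra.mem_center_iff.mpr fun y => (ha i y).symm⟩ :
        Subalgebra.center k B)) p).2 _).symm) :
    Pol k n ⊗[k] ExteriorAlgebra k (Fin n → k) →ₐ[k] B)

theorem lift_x {B : Type v} [Ring B] [Algebra k B] (a b : Fin n → B)
    (ha : ∀ i y, a i * y = y * a i)
    (hb : ∀ i, b i * b i = 0) (hb' : ∀ i j, b i * b j + b j * b i = 0) (i : Fin n) :
    lift (k := k) a b ha hb hb' (x i) = a i := by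
  refine (Algebra.TensorProduct.lift_tmul _ _ _ _ _).trans ?_
  simp

theorem lift_ω {B : Type v} [Ring B] [Algebra k B] (a b : Fin n → B)
    (ha : ∀ i y, a i * y = y * a i)
    (hb : ∀ i, b i * b i = 0) (hb' : ∀ i j, b i * b j + b j * b i = 0) (i : Fin n) :
    lift (k := k) a b ha hb hb' (ω i) = b i := by
  refine (Algebra.TensorProduct.lift_tmul _ _ _ _ _).trans ?_
  simp [Fintype.linearCombination_apply, Pi.single_apply]

/-- The component of bidegree `(s, t)` of `R_n`, where `deg x_i = (2, 0)` and
`deg ω_i = (-2 i, 2)`: it is spanned by the monomials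
`x_1 ^ u_1 ⋯ x_n ^ u_n ω_{i_1} ⋯ ω_{i_r}` of that bidegree. -/
def grading (k : Type u) [CommRing k] (n : ℕ) (s t : ℤ) : Submodule k (R k n) :=
  Submodule.span k {f | ∃ (e : Fin n →₀ ℕ) (L : List (Fin n)),
    f = pol (MvPolynomial.monomial e 1) * (L.map ω).prod ∧
    s = 2 * (∑ i, (e i : ℤ)) - 2 * (L.map fun i => (i.val : ℤ) + 1).sum ∧
    t = 2 * (L.length : ℤ)}

/-! ### The action of the symmetric group -/

theorem linear_anticomm {m : ℕ} (c c' : Fin m → Pol k m) :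
    ((∑ i, pol (c i) * ω i) * (∑ i, pol (c' i) * ω i) +
      (∑ i, pol (c' i) * ω i) * (∑ i, pol (c i) * ω i) : R k m) = 0 := by
  have h : ∀ (p q : Pol k m) (i j : Fin m),
      (pol p * ω i * (pol q * ω j) : R k m) = pol (p * q) * (ω i * ω j) := fun p q i j => by
    rw [mul_assoc, ← mul_assoc (ω i), ← pol_comm q, map_mul]; simp only [mul_assoc]
  simp only [Finset.sum_mul_sum, h]
  conv_lhs => rw [Finset.sum_comm]
  rw [← Finset.sum_add_distrib]
  refine Finset.sum_eq_zero fun i _ => ?_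
  rw [← Finset.sum_add_distrib]
  refine Finset.sum_eq_zero fun j _ => ?_
  rw [mul_comm (c' i), ← mul_add, ω_anticomm, mul_zero]

theorem linear_sq {m : ℕ} (c : Fin m → Pol k m) :
    ((∑ i, pol (c i) * ω i) * (∑ i, pol (c i) * ω i) : R k m) = 0 := by
  have h : ∀ (p q : Pol k m) (i j : Fin m),
      (pol p * ω i * (pol q * ω j) : R k m) = pol (p * q) * (ω i * ω j) := fun p q i j => by
    rw [mul_assoc, ← mul_assoc (ω i), ← pol_comm q, map_mul]; simp only [mul_assoc]
  have key : ∀ s : Finset (Fin m),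
      ((∑ i ∈ s, pol (c i) * ω i) * (∑ i ∈ s, pol (c i) * ω i) : R k m) = 0 := by
    intro s
    induction s using Finset.induction_on with
    | empty => simp
    | insert a s ha ih =>
      rw [Finset.sum_insert ha, add_mul, mul_add, mul_add, ih, add_zero, h, ω_sq, mul_zero,
        zero_add, Finset.mul_sum, Finset.sum_mul, ← Finset.sum_add_distrib]
      refine Finset.sum_eq_zero fun i _ => ?_
      rw [h, h, mul_comm (c i), ← mul_add, ω_anticomm, mul_zero]
  exact key Finset.univ

/-- The simple transposition exchanging (in zero-based numbering) `j` and `j + 1`. -/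
def swap (j : ℕ) (hj : j + 1 < n) : Equiv.Perm (Fin n) :=
  Equiv.swap ⟨j, by omega⟩ ⟨j + 1, hj⟩

/-- The element `ω_i + δ_{i,j} (x_j - x_{j+1}) ω_{j+1}`. -/
def sω (j : ℕ) (hj : j + 1 < n) (i : Fin n) : R k n :=
  ω i + if i.val = j then (x ⟨j, by omega⟩ - x ⟨j + 1, hj⟩) * ω ⟨j + 1, hj⟩ else 0

theorem sω_eq (j : ℕ) (hj : j + 1 < n) (i : Fin n) :
    (sω j hj i : R k n) = ∑ l, pol ((if l = i then 1 else 0) +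
      if i.val = j ∧ l = ⟨j + 1, hj⟩ then
        MvPolynomial.X ⟨j, by omega⟩ - MvPolynomial.X ⟨j + 1, hj⟩ else 0) * ω l := by
  simp only [map_add, add_mul, Finset.sum_add_distrib, sω]
  congr 1
  · rw [Finset.sum_eq_single i]
    · simp
    · intro b _ hb; simp [hb]
    · simp
  · rw [Finset.sum_eq_single ⟨j + 1, hj⟩]
    · split_ifs with h h'
      · simp [x]
      · tauto
      · tauto
      · simp
    · intro b _ hb; simp [hb]
    · simp

/-- The action of the simple transposition `s_j` on `R_n`: it exchanges `x_j` and `x_{j+1}`, fixes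
the other `x_i`, and sends `ω_i` to `ω_i + δ_{i,j} (x_j - x_{j+1}) ω_{j+1}`. -/
def s (j : ℕ) (hj : j + 1 < n) : R k n →ₐ[k] R k n :=
  lift (fun i => x (swap j hj i)) (sω j hj)
    (fun _ _ => pol_comm _ _)
    (fun i => by rw [sω_eq]; exact linear_sq _)
    (fun i i' => by rw [sω_eq, sω_eq]; exact linear_anticomm _ _)

theorem s_x (j : ℕ) (hj : j + 1 < n) (i : Fin n) : s j hj (x i : R k n) = x (swap j hj i) :=
  lift_x _ _ _ _ _ i

theorem s_ω (j : ℕ) (hj : j + 1 < n) (i : Fin n) : s j hj (ω i : R k n) = sω j hj i :=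
  lift_ω _ _ _ _ _ i

theorem s_pol (j : ℕ) (hj : j + 1 < n) (p : Pol k n) :
    s j hj (pol p : R k n) = pol (MvPolynomial.rename (swap j hj) p) := by
  have h : (s j hj).comp pol =
      (pol : Pol k n →ₐ[k] R k n).comp (MvPolynomial.rename (swap j hj)) := by
    refine MvPolynomial.algHom_ext fun i => ?_
    simpa [x] using s_x (k := k) j hj i
  exact DFunLike.congr_fun h p

/-- The subalgebra of `𝔖_n`-invariants of `R_n`; the group is generated by the `s_j`. -/
def invariants (k : Type u) [CommRing k] (n : ℕ) : Subalgebra k (R k n) where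
  carrier := {f | ∀ (j : ℕ) (hj : j + 1 < n), s j hj f = f}
  mul_mem' hf hg j hj := by rw [map_mul, hf j hj, hg j hj]
  add_mem' hf hg j hj := by rw [map_add, hf j hj, hg j hj]
  algebraMap_mem' c j hj := (s j hj).commutes c

/-! ### The enhanced nilHecke algebra -/

/-- The enhanced nilHecke algebra `A_n = End(R_n)`, the algebra of those additive (`k`-linear)
endomorphisms of `R_n` which are linear over `R_n^{𝔖_n}`. As `R_n` is a superalgebra and
`A_n` acts from the left, `R_n^{𝔖_n}` acts by multiplication from the right. -/
def A (k : Type u) [CommRing k] (n : ℕ) : Subalgebra k (Module.End k (R k n)) where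
  carrier := {ξ | ∀ f, ∀ r ∈ invariants k n, ξ (f * r) = ξ f * r}
  mul_mem' {ξ η} hξ hη f r hr := by
    rw [Module.End.mul_apply, Module.End.mul_apply, hη f r hr, hξ _ r hr]
  add_mem' {ξ η} hξ hη f r hr := by
    rw [LinearMap.add_apply, LinearMap.add_apply, hη f r hr, hξ _ r hr, add_mul]
  algebraMap_mem' c f r _ := by
    rw [Module.algebraMap_end_apply, Module.algebraMap_end_apply, smul_mul_assoc]

/-- The inclusion `R_n → A_n`: an element of `R_n` acts on `R_n` by multiplication from the
left. -/
def toA : R k n →ₐ[k] A k n :=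
  (Algebra.lmul k (R k n)).codRestrict (A k n) (fun f g r _ => (mul_assoc f g r).symm)

theorem toA_apply (f g : R k n) : (toA f : A k n).1 g = f * g := rfl

theorem isRegular_X_sub_X (i j : Fin n) (hij : i ≠ j) :
    IsRegular (MvPolynomial.X i - MvPolynomial.X j : Pol k n) := by
  let F : Pol k n →ₐ[k] Pol k n := MvPolynomial.aeval
    (fun l => if l = i then MvPolynomial.X i + MvPolynomial.X j else MvPolynomial.X l)
  let G : Pol k n →ₐ[k] Pol k n := MvPolynomial.aeval
    (fun l => if l = i then MvPolynomial.X i - MvPolynomial.X j else MvPolynomial.X l)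
  have hGF : G.comp F = AlgHom.id k _ := by
    refine MvPolynomial.algHom_ext fun l => ?_
    by_cases hl : l = i
    · subst hl; simp [F, G, hij.symm]
    · simp [F, G, hl]
  have hF : F (MvPolynomial.X i - MvPolynomial.X j) = MvPolynomial.X i := by
    simp [F, hij.symm]
  have hinj : Function.Injective F :=
    Function.LeftInverse.injective (g := G) fun p => DFunLike.congr_fun hGF p
  have hl : IsLeftRegular (MvPolynomial.X i - MvPolynomial.X j : Pol k n) := by
    intro p q hpq
    refine hinj ((MvPolynomial.isRegular_X (n := i)).left ?_)
    have := congrArg F hpq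
    simpa only [map_mul, hF] using this
  exact isLeftRegular_iff_isRegular.mp hl

instance : Module.Free k (ExteriorAlgebra k (Fin n → k)) :=
  Module.Free.of_basis (Pi.basisFun k (Fin n)).ExteriorAlgebra

theorem pol_mul_injective (p : Pol k n) (hp : IsRegular p) (f g : R k n)
    (h : pol p * f = pol p * g) : f = g := by
  have hinj : Function.Injective (LinearMap.rTensor (ExteriorAlgebra k (Fin n → k))
      (LinearMap.mulLeft k p)) :=
    Module.Flat.rTensor_preserves_injective_linearMap _ hp.left
  have hmul : ∀ f : R k n, pol p * f = LinearMap.rTensor (ExteriorAlgebra k (Fin n → k))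
      (LinearMap.mulLeft k p) f := by
    intro f
    induction f using tensor_induction with
    | h0 => rw [mul_zero]; exact (map_zero _).symm
    | hadd f g hf hg => rw [mul_add, hf, hg]; exact (map_add _ _ _).symm
    | hmul q y =>
      rw [← mul_assoc, ← map_mul, pol_mul_ext, pol_mul_ext]
      rfl
  rw [hmul, hmul] at h
  exact hinj h

theorem x_sub_x_cancel (j : ℕ) (hj : j + 1 < n) (f g : R k n)
    (h : (x ⟨j, by omega⟩ - x ⟨j + 1, hj⟩) * f = (x ⟨j, by omega⟩ - x ⟨j + 1, hj⟩) * g) :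
    f = g := by
  refine pol_mul_injective _ (isRegular_X_sub_X ⟨j, by omega⟩ ⟨j + 1, hj⟩ (by simp)) f g ?_
  simpa only [map_sub, x] using h

theorem demazure_exists (j : ℕ) (hj : j + 1 < n) (f : R k n) :
    ∃ g : R k n, (x ⟨j, by omega⟩ - x ⟨j + 1, hj⟩) * g = f - s j hj f := by
  induction f using gen_induction with
  | hc c => exact ⟨0, by simp⟩
  | hx i =>
    rw [s_x, swap]
    by_cases h1 : i = ⟨j, by omega⟩
    · exact ⟨1, by rw [h1, Equiv.swap_apply_left, mul_one]⟩
    by_cases h2 : i = ⟨j + 1, hj⟩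
    · exact ⟨-1, by rw [h2, Equiv.swap_apply_right]; simp⟩
    · exact ⟨0, by rw [Equiv.swap_apply_of_ne_of_ne h1 h2]; simp⟩
  | hω i =>
    rw [s_ω, sω]
    split_ifs with h
    · exact ⟨-ω ⟨j + 1, hj⟩, by simp⟩
    · exact ⟨0, by simp⟩
  | hadd f f' hf hf' =>
    obtain ⟨g, hg⟩ := hf
    obtain ⟨g', hg'⟩ := hf'
    exact ⟨g + g', by rw [mul_add, hg, hg', map_add]; abel⟩
  | hmul f f' hf hf' =>
    obtain ⟨g, hg⟩ := hf
    obtain ⟨g', hg'⟩ := hf'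
    refine ⟨g * f' + s j hj f * g', ?_⟩
    have hc : (x ⟨j, by omega⟩ - x ⟨j + 1, hj⟩ : R k n) * s j hj f =
        s j hj f * (x ⟨j, by omega⟩ - x ⟨j + 1, hj⟩) := by
      simp only [x, ← map_sub]; exact pol_comm _ _
    rw [mul_add, ← mul_assoc, hg, ← mul_assoc, hc, mul_assoc, hg', map_mul]
    noncomm_ring

/-- The value at `f` of the divided difference operator: the unique `g` with
`(x_j - x_{j+1}) g = f - s_j(f)`. -/
def demazure (j : ℕ) (hj : j + 1 < n) (f : R k n) : R k n :=
  Classical.choose (demazure_exists j hj f)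

theorem demazure_spec (j : ℕ) (hj : j + 1 < n) (f : R k n) :
    (x ⟨j, by omega⟩ - x ⟨j + 1, hj⟩) * demazure j hj f = f - s j hj f :=
  Classical.choose_spec (demazure_exists j hj f)

/-- The generator `T_j` of `A_n`, acting on `R_n` as the divided difference operator
`f ↦ (f - s_j(f)) / (x_j - x_{j+1})`. -/
def T (j : ℕ) (hj : j + 1 < n) : A k n where
  val :=
    { toFun := demazure j hj
      map_add' := fun f g => by
        apply x_sub_x_cancel j hj
        rw [mul_add, demazure_spec, demazure_spec, demazure_spec, map_add]; abel
      map_smul' := fun c f => by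
        apply x_sub_x_cancel j hj
        rw [RingHom.id_apply, mul_smul_comm, demazure_spec, demazure_spec, map_smul, smul_sub] }
  property := fun f r hr => by
    apply x_sub_x_cancel j hj
    change _ * demazure j hj (f * r) = _ * (demazure j hj f * r)
    rw [← mul_assoc, demazure_spec, demazure_spec, map_mul, hr j hj, sub_mul]

/-- The component of bidegree `(s, t)` of `A_n`: the endomorphisms that are homogeneous of that
bidegree. The parity is half of the second degree, modulo two. -/
def gradingA (k : Type u) [CommRing k] (n : ℕ) (s t : ℤ) : Submodule k (A k n) where
  carrier := {ξ | ∀ s' t' : ℤ, ∀ f ∈ grading k n s' t', ξ.1 f ∈ grading k n (s' + s) (t' + t)}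
  zero_mem' _ _ _ _ := Submodule.zero_mem _
  add_mem' hξ hη s' t' f hf := Submodule.add_mem _ (hξ s' t' f hf) (hη s' t' f hf)
  smul_mem' c _ hξ s' t' f hf := Submodule.smul_mem _ c (hξ s' t' f hf)

/-! ### The derivations -/

/-- The polynomials `α_{i,j} = ∑_{l=j}^n x_l² ∏_{k=i+1}^{j-1} (x_k - x_l)`. -/
def α (i j : Fin n) : Pol k n :=
  ∑ l ∈ Finset.Ici j, MvPolynomial.X l ^ 2 *
    ∏ m ∈ Finset.Ioo i j, (MvPolynomial.X m - MvPolynomial.X l)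

/-- The element `d_n(ω_i) = ∑_{j=i+1}^n α_{i,j} ω_j`. -/
def dω (i : Fin n) : R k n := ∑ j ∈ Finset.Ioi i, pol (α i j) * ω j

theorem dω_eq (i : Fin n) :
    (dω i : R k n) = ∑ j, pol (if i < j then α i j else 0) * ω j := by
  rw [dω, ← Finset.sum_filter_add_sum_filter_not Finset.univ (fun j => i < j)]
  rw [Finset.sum_eq_zero (s := Finset.univ.filter fun j => ¬ i < j), add_zero]
  · refine Finset.sum_congr (by ext; simp) fun j hj => ?_
    rw [if_pos (Finset.mem_filter.mp hj).2]
  · intro j hj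
    rw [if_neg (Finset.mem_filter.mp hj).2, map_zero, zero_mul]

theorem ω_eq (i : Fin n) : (ω i : R k n) = ∑ j, pol (if j = i then 1 else 0) * ω j := by
  rw [Finset.sum_eq_single i]
  · simp
  · intro b _ hb; simp [hb]
  · simp

/-- The algebra map `f ↦ f + d_n(f) ε` from `R_n` to `R_n[ε]`, `ε² = 0`, which encodes the
derivation `d_n`. -/
def dHom : R k n →ₐ[k] TrivSqZeroExt (R k n) (R k n) :=
  lift (fun i => TrivSqZeroExt.inl (x i) + TrivSqZeroExt.inr (x i ^ 2))
    (fun i => TrivSqZeroExt.inl (ω i) + TrivSqZeroExt.inr (dω i))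
    (fun i y => by
      have h1 : ∀ f : R k n, x i * f = f * x i := pol_comm _
      have h2 : ∀ f : R k n, x i ^ 2 * f = f * x i ^ 2 := fun f => by
        rw [x, ← map_pow]; exact pol_comm _ f
      refine TrivSqZeroExt.ext ?_ ?_
      · simp [h1]
      · simp [h1, h2, add_comm])
    (fun i => by
      refine TrivSqZeroExt.ext ?_ ?_
      · simp [ω_sq]
      · simp only [TrivSqZeroExt.snd_mul, TrivSqZeroExt.fst_add, TrivSqZeroExt.snd_add,
          TrivSqZeroExt.fst_inl, TrivSqZeroExt.fst_inr, TrivSqZeroExt.snd_inl,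
          TrivSqZeroExt.snd_inr, add_zero, zero_add, smul_eq_mul, MulOpposite.smul_eq_mul_unop,
          MulOpposite.unop_op, TrivSqZeroExt.snd_zero]
        rw [ω_eq, dω_eq]; exact linear_anticomm _ _)
    (fun i j => by
      refine TrivSqZeroExt.ext ?_ ?_
      · simp [ω_anticomm]
      · simp only [TrivSqZeroExt.snd_mul, TrivSqZeroExt.fst_add, TrivSqZeroExt.snd_add,
          TrivSqZeroExt.fst_inl, TrivSqZeroExt.fst_inr, TrivSqZeroExt.snd_inl,
          TrivSqZeroExt.snd_inr, add_zero, zero_add, smul_eq_mul, MulOpposite.smul_eq_mul_unop,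
          MulOpposite.unop_op, TrivSqZeroExt.snd_zero]
        have h1 : (ω i * dω j + dω j * ω i : R k n) = 0 := by
          rw [ω_eq, dω_eq]; exact linear_anticomm _ _
        have h2 : (dω i * ω j + ω j * dω i : R k n) = 0 := by
          rw [ω_eq, dω_eq]; exact linear_anticomm _ _
        calc _ = (ω i * dω j + dω j * ω i) + (dω i * ω j + ω j * dω i : R k n) := by abel
          _ = 0 := by rw [h1, h2, add_zero])

/-- The derivation `d_n` of `R_n` with `d_n(x_i) = x_i²` and
`d_n(ω_i) = ∑_{j=i+1}^n α_{i,j} ω_j`. -/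
def d : R k n →ₗ[k] R k n where
  toFun f := (dHom f).snd
  map_add' f g := by rw [map_add, TrivSqZeroExt.snd_add]
  map_smul' c f := by rw [map_smul, TrivSqZeroExt.snd_smul, RingHom.id_apply]

theorem d_x (i : Fin n) : d (x i : R k n) = x i ^ 2 := by
  change (dHom (x i : R k n)).snd = _
  rw [dHom, lift_x]; simp

theorem d_ω (i : Fin n) : d (ω i : R k n) = dω i := by
  change (dHom (ω i : R k n)).snd = _
  rw [dHom, lift_ω]; simp

theorem fst_dHom (f : R k n) : (dHom f).fst = f := by
  induction f using gen_induction with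
  | hc c => rw [AlgHom.commutes]; rfl
  | hx i => rw [dHom, lift_x]; simp
  | hω i => rw [dHom, lift_ω]; simp
  | hadd f g hf hg => rw [map_add, TrivSqZeroExt.fst_add, hf, hg]
  | hmul f g hf hg => rw [map_mul, TrivSqZeroExt.fst_mul, hf, hg]

/-- The Leibniz rule. -/
theorem d_mul (f g : R k n) : d (f * g) = d f * g + f * d g := by
  change (dHom (f * g)).snd = (dHom f).snd * g + f * (dHom g).snd
  rw [map_mul, TrivSqZeroExt.snd_mul, fst_dHom, fst_dHom, add_comm]
  rfl

theorem d_algebraMap (c : k) : d (algebraMap k (R k n) c) = 0 := by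
  change (dHom (algebraMap k (R k n) c)).snd = 0
  rw [AlgHom.commutes]; rfl

/-! `d_n` commutes with the action of the symmetric group. -/

/-- The element `∑_{l=i+1}^n ∏_{m=i+1}^{l-1} (x_m - t) ω_l`. -/
def chain (t : Pol k n) (i : Fin n) : R k n :=
  ∑ l ∈ Finset.Ioi i, pol (∏ m ∈ Finset.Ioo i l, (MvPolynomial.X m - t)) * ω l

theorem dω_eq_chain (i : Fin n) :
    (dω i : R k n) = ∑ r ∈ Finset.Ioi i, x r ^ 2 * chain (MvPolynomial.X r) i := by
  have h1 : (dω i : R k n) = ∑ j ∈ Finset.Ioi i, ∑ r ∈ Finset.Ioi i,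
      pol (MvPolynomial.X r ^ 2 *
        ∏ m ∈ Finset.Ioo i j, (MvPolynomial.X m - MvPolynomial.X r)) * ω j := by
    refine Finset.sum_congr rfl fun j hj => ?_
    rw [α, map_sum, Finset.sum_mul]
    have hij := Finset.mem_Ioi.mp hj
    refine Finset.sum_subset (fun r hr => ?_) (fun r hr hr' => ?_)
    · rw [Finset.mem_Ioi]; exact hij.trans_le (Finset.mem_Ici.mp hr)
    · rw [Finset.prod_eq_zero (i := r), mul_zero, map_zero, zero_mul]
      · rw [Finset.mem_Ici, not_le] at hr'
        exact Finset.mem_Ioo.mpr ⟨Finset.mem_Ioi.mp hr, hr'⟩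
      · rw [sub_self]
  rw [h1, Finset.sum_comm]
  refine Finset.sum_congr rfl fun r _ => ?_
  rw [chain, Finset.mul_sum]
  refine Finset.sum_congr rfl fun j _ => ?_
  rw [map_mul, map_pow, mul_assoc]; rfl

theorem Ioi_succ (i : ℕ) (hi : i + 1 < n) :
    Finset.Ioi (⟨i, by omega⟩ : Fin n) = insert ⟨i + 1, hi⟩ (Finset.Ioi ⟨i + 1, hi⟩) := by
  ext l
  simp only [Finset.mem_Ioi, Finset.mem_insert, Fin.lt_def, Fin.ext_iff]
  omega

theorem chain_succ (t : Pol k n) (i : ℕ) (hi : i + 1 < n) :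
    (chain t ⟨i, by omega⟩ : R k n) = ω ⟨i + 1, hi⟩ +
      pol (MvPolynomial.X ⟨i + 1, hi⟩ - t) * chain t ⟨i + 1, hi⟩ := by
  rw [chain, Ioi_succ i hi, Finset.sum_insert (by simp)]
  congr 1
  · rw [Finset.prod_eq_one, map_one, one_mul]
    intro m hm
    simp only [Finset.mem_Ioo, Fin.lt_def] at hm
    omega
  · rw [chain, Finset.mul_sum]
    refine Finset.sum_congr rfl fun l hl => ?_
    rw [← mul_assoc, ← map_mul]
    congr 2
    have : Finset.Ioo (⟨i, by omega⟩ : Fin n) l =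
        insert ⟨i + 1, hi⟩ (Finset.Ioo ⟨i + 1, hi⟩ l) := by
      ext m
      simp only [Finset.mem_Ioi, Finset.mem_Ioo, Finset.mem_insert, Fin.lt_def,
        Fin.ext_iff] at hl ⊢
      omega
    rw [this, Finset.prod_insert (by simp)]

theorem chain_last (t : Pol k n) (i : Fin n) (hi : ¬ i.val + 1 < n) : (chain t i : R k n) = 0 := by
  rw [chain, Finset.sum_eq_zero]
  intro l hl
  have := Finset.mem_Ioi.mp hl
  rw [Fin.lt_def] at this
  omega

theorem swap_ne (j : ℕ) (hj : j + 1 < n) (i : Fin n) (h1 : i.val ≠ j) (h2 : i.val ≠ j + 1) :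
    swap j hj i = i :=
  Equiv.swap_apply_of_ne_of_ne (fun h => h1 (congrArg Fin.val h)) (fun h => h2 (congrArg Fin.val h))

theorem s_ω_ne (j : ℕ) (hj : j + 1 < n) (i : Fin n) (h : i.val ≠ j) :
    s j hj (ω i : R k n) = ω i := by
  rw [s_ω, sω, if_neg h, add_zero]

theorem s_chain (t : Pol k n) (j : ℕ) (hj : j + 1 < n) (i : Fin n) (hij : i.val ≠ j) :
    s j hj (chain t i : R k n) = chain (MvPolynomial.rename (swap j hj) t) i := by
  obtain ⟨m, hm⟩ : ∃ m, m = n - i.val := ⟨_, rfl⟩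
  induction m using Nat.strong_induction_on generalizing i with
  | _ m ih =>
  obtain ⟨i, hin⟩ := i
  simp only at hij hm
  by_cases hi : i + 1 < n
  swap
  · rw [chain_last _ _ hi, chain_last _ _ hi, map_zero]
  by_cases hij1 : i + 1 = j
  · subst hij1
    have e1 : swap (i + 1) hj ⟨i + 1, hi⟩ = ⟨i + 1 + 1, hj⟩ := Equiv.swap_apply_left _ _
    have e2 : swap (i + 1) hj ⟨i + 1 + 1, hj⟩ = ⟨i + 1, hi⟩ := Equiv.swap_apply_right _ _
    rw [chain_succ _ i hi, chain_succ _ (i + 1) hj, chain_succ _ i hi, chain_succ _ (i + 1) hj,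
      map_add, map_mul, map_add, map_mul, s_pol, s_pol, s_ω, sω, if_pos rfl,
      s_ω_ne _ _ _ (by simp), ih (n - (i + 1 + 1)) (by omega) ⟨i + 1 + 1, hj⟩ (by simp) rfl]
    simp only [map_sub, MvPolynomial.rename_X, e1, e2, x]
    have hc := pol_comm (k := k) (n := n) (MvPolynomial.X ⟨i + 1, hi⟩)
      (pol (MvPolynomial.X ⟨i + 1 + 1, hj⟩))
    have hc1 := pol_comm (k := k) (n := n) (MvPolynomial.rename (swap (i + 1) hj) t)
      (pol (MvPolynomial.X ⟨i + 1 + 1, hj⟩))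
    have hc2 := pol_comm (k := k) (n := n) (MvPolynomial.rename (swap (i + 1) hj) t)
      (pol (MvPolynomial.X ⟨i + 1, hi⟩))
    simp only [mul_add, sub_mul, mul_sub, ← mul_assoc]
    rw [hc, hc1, hc2]
    abel
  · rw [chain_succ _ i hi, chain_succ _ i hi, map_add, map_mul, s_pol,
      s_ω_ne _ _ _ (by simpa using hij1),
      ih (n - (i + 1)) (by omega) ⟨i + 1, hi⟩ (by simpa using hij1) rfl, map_sub,
      MvPolynomial.rename_X, swap_ne j hj _ (by simpa using hij1) (by simpa using hij)]

theorem s_dω_ne (j : ℕ) (hj : j + 1 < n) (i : Fin n) (hij : i.val ≠ j) :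
    s j hj (dω i : R k n) = dω i := by
  rw [dω_eq_chain, map_sum]
  refine Finset.sum_equiv (swap j hj) (fun r => ?_) (fun r _ => ?_)
  · simp only [Finset.mem_Ioi, Fin.lt_def]
    by_cases h1 : r = ⟨j, by omega⟩
    · rw [h1, swap, Equiv.swap_apply_left]; simp only; omega
    by_cases h2 : r = ⟨j + 1, hj⟩
    · rw [h2, swap, Equiv.swap_apply_right]; simp only; omega
    · rw [swap, Equiv.swap_apply_of_ne_of_ne h1 h2]
  · rw [map_mul, map_pow, s_x, s_chain _ _ _ _ hij, MvPolynomial.rename_X]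

theorem s_dω_self (j : ℕ) (hj : j + 1 < n) :
    s j hj (dω ⟨j, by omega⟩ : R k n) = dω ⟨j, by omega⟩ +
      ((x ⟨j, by omega⟩ ^ 2 - x ⟨j + 1, hj⟩ ^ 2) * ω ⟨j + 1, hj⟩ +
        (x ⟨j, by omega⟩ - x ⟨j + 1, hj⟩) * dω ⟨j + 1, hj⟩) := by
  have e1 : swap j hj ⟨j + 1, hj⟩ = ⟨j, by omega⟩ := Equiv.swap_apply_right _ _
  have hs : ∀ t : Pol k n, s j hj (chain t ⟨j, by omega⟩ : R k n) = ω ⟨j + 1, hj⟩ +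
      pol (MvPolynomial.X ⟨j, by omega⟩ - MvPolynomial.rename (swap j hj) t) *
        chain (MvPolynomial.rename (swap j hj) t) ⟨j + 1, hj⟩ := fun t => by
    rw [chain_succ t j hj, map_add, map_mul, s_pol, s_ω_ne _ _ _ (by simp),
      s_chain _ _ _ _ (by simp), map_sub, MvPolynomial.rename_X, e1]
  rw [dω_eq_chain, dω_eq_chain, Ioi_succ j hj, Finset.sum_insert (by simp),
    map_add, map_sum, map_mul, map_pow, s_x, e1, hs,
    MvPolynomial.rename_X, e1, sub_self, map_zero, zero_mul, add_zero, chain_succ _ j hj,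
    sub_self, map_zero, zero_mul, add_zero, Finset.mul_sum]
  have hsum : ∑ r ∈ Finset.Ioi (⟨j + 1, hj⟩ : Fin n),
        s j hj (x r ^ 2 * chain (MvPolynomial.X r) ⟨j, by omega⟩ : R k n) =
      ∑ r ∈ Finset.Ioi (⟨j + 1, hj⟩ : Fin n), x r ^ 2 * chain (MvPolynomial.X r) ⟨j, by omega⟩ +
      ∑ r ∈ Finset.Ioi (⟨j + 1, hj⟩ : Fin n), (x ⟨j, by omega⟩ - x ⟨j + 1, hj⟩) *
        (x r ^ 2 * chain (MvPolynomial.X r) ⟨j + 1, hj⟩) := by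
    rw [← Finset.sum_add_distrib]
    refine Finset.sum_congr rfl fun r hr => ?_
    have hr' := Finset.mem_Ioi.mp hr
    rw [Fin.lt_def] at hr'
    simp only at hr'
    have e2 : swap j hj r = r := swap_ne j hj r (by omega) (by omega)
    have hc : ((x ⟨j, by omega⟩ - x ⟨j + 1, hj⟩) * x r ^ 2 : R k n) =
        x r ^ 2 * (x ⟨j, by omega⟩ - x ⟨j + 1, hj⟩) := by
      simp only [x, ← map_sub, ← map_pow]; exact pol_comm _ _
    rw [map_mul, map_pow, s_x, e2, hs, MvPolynomial.rename_X, e2, chain_succ _ j hj,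
      ← mul_assoc (x ⟨j, by omega⟩ - x ⟨j + 1, hj⟩ : R k n), hc]
    simp only [x, map_sub, mul_add, sub_mul, mul_sub, mul_assoc]
    abel
  rw [hsum, sub_mul]
  abel

/-- `d_n` is equivariant for the action of the symmetric group. -/
theorem s_d (j : ℕ) (hj : j + 1 < n) (f : R k n) : s j hj (d f) = d (s j hj f) := by
  induction f using gen_induction with
  | hc c => rw [d_algebraMap, AlgHom.commutes, d_algebraMap, map_zero]
  | hx i => rw [d_x, map_pow, s_x, d_x]
  | hω i =>
    rw [d_ω]
    by_cases h : i.val = j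
    · obtain ⟨i, hi⟩ := i
      simp only at h
      subst h
      rw [s_ω, sω, if_pos rfl, map_add, d_mul, map_sub, d_x, d_x, d_ω, d_ω, s_dω_self]
    · rw [s_ω_ne j hj i h, d_ω, s_dω_ne j hj i h]
  | hadd f g hf hg => simp only [map_add, hf, hg]
  | hmul f g hf hg => simp only [d_mul, map_add, map_mul, hf, hg]

/-- The derivation of the free module `R_n v`, with generator `v` and
`d(v) = (∑ c_i x_i) v`, written on the coefficient of `v`: `f ↦ d_n(f) + f ∑ c_i x_i`. -/
def dTwist (c : Fin n → k) : R k n →ₗ[k] R k n :=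
  d + LinearMap.mulRight k (∑ i, c i • x i)

theorem dTwist_mul (c : Fin n → k) (f g : R k n) :
    dTwist c (f * g) = dTwist c f * g + f * d g := by
  have hc : (∑ i, c i • x i) * g = g * ∑ i, c i • x i := by
    have : (∑ i, c i • x i : R k n) = pol (∑ i, c i • MvPolynomial.X i) := by
      simp only [map_sum, map_smul, x]
    rw [this]; exact pol_comm _ _
  simp only [dTwist, LinearMap.add_apply, LinearMap.mulRight_apply, d_mul, add_mul]
  rw [mul_assoc f (∑ i, c i • x i) g, hc, mul_assoc]
  abel

/-- The derivation of `A_n` induced by the derivation `D` of the module `R_n v` with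
`D(v) = (∑ c_i x_i) v`, namely `ξ ↦ D ∘ ξ - ξ ∘ D`. When `c_{i+1} - c_i = a` for all `i` this is
the derivation `d_a` of `A_n`. -/
def dA (c : Fin n → k) : A k n →ₗ[k] A k n where
  toFun ξ := ⟨dTwist c ∘ₗ ξ.1 - ξ.1 ∘ₗ dTwist c, fun f r hr => by
    have hdr : d r ∈ invariants k n := fun j hj => by rw [s_d, hr j hj]
    simp only [LinearMap.sub_apply, LinearMap.comp_apply]
    rw [dTwist_mul, map_add, ξ.2 f r hr, ξ.2 f _ hdr, ξ.2 _ r hr, dTwist_mul]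
    noncomm_ring⟩
  map_add' ξ η := by
    apply Subtype.ext
    change dTwist c ∘ₗ (ξ.1 + η.1) - (ξ.1 + η.1) ∘ₗ dTwist c =
      (dTwist c ∘ₗ ξ.1 - ξ.1 ∘ₗ dTwist c) + (dTwist c ∘ₗ η.1 - η.1 ∘ₗ dTwist c)
    rw [LinearMap.comp_add, LinearMap.add_comp]; abel
  map_smul' b ξ := by
    apply Subtype.ext
    change dTwist c ∘ₗ (b • ξ.1) - (b • ξ.1) ∘ₗ dTwist c =
      b • (dTwist c ∘ₗ ξ.1 - ξ.1 ∘ₗ dTwist c)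
    rw [LinearMap.comp_smul, LinearMap.smul_comp, smul_sub]

/-! ### The image of `ω_i` -/

/-- The element
`ω_i - ∑_{l=i+1}^{n+1} x_{n+1} ∏_{j=i+1}^{l-1} (x_j - x_{n+1}) ω_l` of `R_{n+1}`, for
`1 ≤ i ≤ n`. -/
def φω (i : Fin n) : R k (n + 1) :=
  ω i.castSucc - ∑ l ∈ Finset.Ioi i.castSucc,
    pol (MvPolynomial.X (Fin.last n) *
      ∏ j ∈ Finset.Ioo i.castSucc l, (MvPolynomial.X j - MvPolynomial.X (Fin.last n))) * ω l

end

end EnhancedNilHecke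

namespace EnhancedNilHecke

noncomputable section

universe u v

variable {k : Type u} [CommRing k] {n : ℕ}

/-! ### `R_n` as an algebra over its central subring of polynomials -/

/-! The homomorphism `φ'` exists by the universal property of `R_n`: the `x_i` are central and the
proposed images of the `ω_i` are linear forms in the `ω_l` over the polynomials, hence square to
zero and anticommute. Each image is `ω_i - x_{n+1} U_i`, where `U_i` is the chain at `t = x_{n+1}`.
Chains obey `chain t i = ω_{i+1} + (x_{i+1} - t) chain t (i+1)`, and every identity needed about
them follows by downward induction on `i`. This yields compatibility with `d` (`d_chain`,
`φ'_chain`, `φ'_dω`) and with `s_j` for `j < n` (`s_φω`).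

The map `φ` rests on the decomposition of `R_{n+1}` as the direct sum of the `φ'(R_n) x_{n+1}^a
ω_{n+1}^e` with `e ∈ {0, 1}` (`assembleEquiv`). Spanning comes from solving for the `ω_i` by
downward induction. Independence comes from an endomorphism of `R_{n+1}` that turns `φ'` into the
standard inclusion, followed by a matrix representation that reads off coefficients. An endomorphism
`ξ` of `R_n` is then extended by acting on coefficients: `φ'(f) m ↦ φ'(ξ f) m` for `m = x_{n+1}^a
ω_{n+1}^e`.

The extension lies in `A_{n+1}` because an invariant of `R_{n+1}` is in particular fixed by the
`s_j` with `j < n`. These fix the `m` and commute with `φ'`, so its coefficients are invariants of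
`R_n`. Moving such a coefficient to the left of `m` costs only a parity automorphism, which
preserves invariants. All remaining claims about `φ` are checked on the elements `φ'(f) m`. For the
derivations, the operator `D` of `R_{n+1}` differs from that of `R_n` acting on coefficients by
multiplication with a multiple of the invariant `∑ x_i` and by an operator raising the power of
`x_{n+1}`; both commute with `φ(ξ)`. -/

instance : Algebra (Pol k n) (R k n) := (pol : Pol k n →ₐ[k] R k n).toRingHom.toAlgebra' pol_comm

theorem smul_eq_pol_mul (p : Pol k n) (f : R k n) : p • f = pol p * f := rfl

theorem x_mul (i : Fin n) (f : R k n) : x i * f = (MvPolynomial.X i : Pol k n) • f := rfl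

theorem x_sq_mul (i : Fin n) (f : R k n) :
    x i ^ 2 * f = (MvPolynomial.X i ^ 2 : Pol k n) • f := by
  rw [smul_eq_pol_mul, map_pow, x]

theorem d_X_smul (i : Fin n) (f : R k n) :
    d ((MvPolynomial.X i : Pol k n) • f) =
      (MvPolynomial.X i ^ 2 : Pol k n) • f + (MvPolynomial.X i : Pol k n) • d f := by
  rw [← x_mul, d_mul, d_x, x_sq_mul, x_mul]

/-- The submodule of linear forms `∑ c_i ω_i`, with polynomial coefficients `c_i`. -/
def linearForms (k : Type u) [CommRing k] (n : ℕ) : Submodule (Pol k n) (R k n) :=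
  Submodule.span (Pol k n) (Set.range ω)

theorem mem_linearForms_iff {f : R k n} :
    f ∈ linearForms k n ↔ ∃ c : Fin n → Pol k n, ∑ i, pol (c i) * ω i = f :=
  Submodule.mem_span_range_iff_exists_fun _

theorem ω_mem_linearForms (i : Fin n) : (ω i : R k n) ∈ linearForms k n :=
  Submodule.subset_span ⟨i, rfl⟩

theorem linearForms_sq {f : R k n} (hf : f ∈ linearForms k n) : f * f = 0 := by
  obtain ⟨c, rfl⟩ := mem_linearForms_iff.mp hf
  exact linear_sq c

theorem linearForms_anticomm {f g : R k n} (hf : f ∈ linearForms k n) (hg : g ∈ linearForms k n) :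
    f * g + g * f = 0 := by
  obtain ⟨c, rfl⟩ := mem_linearForms_iff.mp hf
  obtain ⟨c', rfl⟩ := mem_linearForms_iff.mp hg
  exact linear_anticomm c c'

/-! ### Chains -/

/-- The element `∑_{l=i+1}^n ∏_{m=i+1}^{l-1} (x_m - t) v_l`. -/
def chainOf (t : Pol k n) (v : Fin n → R k n) (i : Fin n) : R k n :=
  ∑ l ∈ Finset.Ioi i, (∏ m ∈ Finset.Ioo i l, (MvPolynomial.X m - t)) • v l

theorem chainOf_succ (t : Pol k n) (v : Fin n → R k n) (i : ℕ) (hi : i + 1 < n) :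
    chainOf t v ⟨i, by omega⟩ = v ⟨i + 1, hi⟩ +
      (MvPolynomial.X ⟨i + 1, hi⟩ - t) • chainOf t v ⟨i + 1, hi⟩ := by
  rw [chainOf, Ioi_succ i hi, Finset.sum_insert (by simp)]
  congr 1
  · rw [Finset.prod_eq_one, one_smul]
    intro m hm
    simp only [Finset.mem_Ioo, Fin.lt_def] at hm
    omega
  · rw [chainOf, Finset.smul_sum]
    refine Finset.sum_congr rfl fun l hl => ?_
    rw [smul_smul]
    congr 1
    have : Finset.Ioo (⟨i, by omega⟩ : Fin n) l =
        insert ⟨i + 1, hi⟩ (Finset.Ioo ⟨i + 1, hi⟩ l) := by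
      ext m
      simp only [Finset.mem_Ioi, Finset.mem_Ioo, Finset.mem_insert, Fin.lt_def,
        Fin.ext_iff] at hl ⊢
      omega
    rw [this, Finset.prod_insert (by simp)]

theorem Ioi_last : Finset.Ioi (Fin.last n) = ∅ := by
  ext l
  simpa using Fin.le_last l

theorem chainOf_last (t : Pol k (n + 1)) (v : Fin (n + 1) → R k (n + 1)) :
    chainOf t v (Fin.last n) = 0 := by
  rw [chainOf, Ioi_last, Finset.sum_empty]

theorem chainOf_castSucc (t : Pol k (n + 1)) (v : Fin (n + 1) → R k (n + 1)) (i : Fin n) :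
    chainOf t v i.castSucc = v i.succ + (MvPolynomial.X i.succ - t) • chainOf t v i.succ :=
  chainOf_succ t v i.val (by omega)

/-- Since the polynomials act by multiplication through `pol`, `chain t` is definitionally `chainOf
t ω`. The general `chainOf` is needed because chains of chains occur below. -/
theorem chain_castSucc (t : Pol k (n + 1)) (i : Fin n) :
    (chain t i.castSucc : R k (n + 1)) =
      ω i.succ + (MvPolynomial.X i.succ - t) • chain t i.succ :=
  chainOf_castSucc t ω i

theorem chain_last_eq_zero (t : Pol k (n + 1)) : (chain t (Fin.last n) : R k (n + 1)) = 0 :=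
  chainOf_last t ω

theorem chain_mem_linearForms (t : Pol k n) (i : Fin n) : (chain t i : R k n) ∈ linearForms k n :=
  Submodule.sum_mem _ fun l _ => Submodule.smul_mem _ _ (ω_mem_linearForms l)

theorem Ioi_castSucc_eq_insert (i : Fin n) :
    Finset.Ioi i.castSucc = insert i.succ (Finset.Ioi i.succ) :=
  Ioi_succ i.val (by omega)

theorem sum_Ioi_castSucc {M : Type*} [AddCommMonoid M] (i : Fin n) (g : Fin (n + 1) → M) :
    ∑ r ∈ Finset.Ioi i.castSucc, g r = ∑ r ∈ Finset.Ioi i, g r.castSucc + g (Fin.last n) := by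
  have h : ∀ (m : ℕ) (j : Fin m), Finset.Ioi j = Finset.univ.filter (j < ·) := fun m j => by
    ext; simp
  rw [h, h, Finset.sum_filter, Finset.sum_filter, Fin.sum_univ_castSucc,
    if_pos (Fin.castSucc_lt_last i)]
  rfl

/-- The divided difference of `t ↦ chain t i` at `t` and `u`, up to sign. -/
theorem chain_eq_sub (t u : Pol k (n + 1)) (i : Fin (n + 1)) :
    (chain t i : R k (n + 1)) = chain u i - (t - u) • chainOf t (chain u) i := by
  induction i using Fin.reverseInduction with
  | last => simp only [chain_last_eq_zero, chainOf_last, smul_zero, sub_zero]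
  | cast i ih =>
    rw [chain_castSucc, chain_castSucc, chainOf_castSucc, ih]
    module

theorem dω_castSucc (i : Fin n) : (dω i.castSucc : R k (n + 1)) =
    ∑ r ∈ Finset.Ioi i, (MvPolynomial.X r.castSucc ^ 2 : Pol k (n + 1)) •
      chain (MvPolynomial.X r.castSucc) i.castSucc +
    (MvPolynomial.X (Fin.last n) ^ 2 : Pol k (n + 1)) •
      chain (MvPolynomial.X (Fin.last n)) i.castSucc := by
  simp only [dω_eq_chain, x_sq_mul, sum_Ioi_castSucc]

theorem dω_last : (dω (Fin.last n) : R k (n + 1)) = 0 := by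
  rw [dω, Ioi_last, Finset.sum_empty]

/-- Both sides satisfy the same recursion in `i`. The second summand on the left keeps the identity
uniform in `j`; for `j = n+1` it cancels the top term on the right, leaving a formula that involves
only `r ≤ n`. -/
theorem d_chain (j i : Fin (n + 1)) :
    d (chain (MvPolynomial.X j) i : R k (n + 1)) +
      (MvPolynomial.X j ^ 2 : Pol k (n + 1)) •
        chainOf (MvPolynomial.X j) (chain (MvPolynomial.X j)) i =
    ∑ r ∈ Finset.Ioi i, (MvPolynomial.X r ^ 2 : Pol k (n + 1)) •
      chainOf (MvPolynomial.X r) (chain (MvPolynomial.X j)) i := by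
  induction i using Fin.reverseInduction with
  | last => simp [chain_last_eq_zero, chainOf_last, Ioi_last]
  | cast i ih =>
    set u : Pol k (n + 1) := MvPolynomial.X j with hu
    set y : Pol k (n + 1) := MvPolynomial.X i.succ with hy
    -- The chains at the various `x_r` are expanded around the single point `u`, so that they can be
    -- compared with the chains of `chain u` on the right-hand side.
    have hdω : (dω i.succ : R k (n + 1)) = ∑ r ∈ Finset.Ioi i.succ,
        (MvPolynomial.X r ^ 2 : Pol k (n + 1)) •
          (chain u i.succ - (MvPolynomial.X r - u) • chainOf (MvPolynomial.X r) (chain u) i.succ) := by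
      rw [dω_eq_chain]
      refine Finset.sum_congr rfl fun r _ => ?_
      rw [x_sq_mul, chain_eq_sub _ u]
    have hsum : ∑ r ∈ Finset.Ioi i.succ, (MvPolynomial.X r ^ 2 : Pol k (n + 1)) •
          chainOf (MvPolynomial.X r) (chain u) i.castSucc =
        dω i.succ + (y - u) • ∑ r ∈ Finset.Ioi i.succ, (MvPolynomial.X r ^ 2 : Pol k (n + 1)) •
          chainOf (MvPolynomial.X r) (chain u) i.succ := by
      rw [hdω, Finset.smul_sum, ← Finset.sum_add_distrib]
      refine Finset.sum_congr rfl fun r _ => ?_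
      rw [chainOf_castSucc]
      module
    rw [Ioi_castSucc_eq_insert, Finset.sum_insert (by simp), hsum, ← ih, chain_castSucc,
      chainOf_castSucc, chainOf_castSucc, map_add, d_ω, sub_smul, map_sub, hy, hu, d_X_smul,
      d_X_smul]
    module

/-! ### The homomorphism `R_n → R_{n+1}` -/

theorem φω_eq_chain (i : Fin n) : (φω i : R k (n + 1)) = ω i.castSucc -
    (MvPolynomial.X (Fin.last n) : Pol k (n + 1)) •
      chain (MvPolynomial.X (Fin.last n)) i.castSucc := by
  rw [φω, chain, Finset.smul_sum]
  congr 1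
  refine Finset.sum_congr rfl fun l _ => ?_
  rw [smul_eq_pol_mul, ← mul_assoc, ← map_mul]

theorem φω_mem_linearForms (i : Fin n) : (φω i : R k (n + 1)) ∈ linearForms k (n + 1) := by
  rw [φω_eq_chain]
  exact sub_mem (ω_mem_linearForms _) (Submodule.smul_mem _ _ (chain_mem_linearForms _ _))

/-- The homomorphism `φ'_n : R_n → R_{n+1}`. -/
def φ' : R k n →ₐ[k] R k (n + 1) :=
  lift (fun i => x i.castSucc) φω (fun _ _ => pol_comm _ _)
    (fun i => linearForms_sq (φω_mem_linearForms i))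
    (fun i j => linearForms_anticomm (φω_mem_linearForms i) (φω_mem_linearForms j))

theorem φ'_x (i : Fin n) : φ' (x i : R k n) = x i.castSucc := lift_x _ _ _ _ _ i

theorem φ'_ω (i : Fin n) : φ' (ω i : R k n) = φω i := lift_ω _ _ _ _ _ i

theorem φ'_X_smul (i : Fin n) (f : R k n) : φ' ((MvPolynomial.X i : Pol k n) • f) =
    (MvPolynomial.X i.castSucc : Pol k (n + 1)) • φ' f := by
  rw [← x_mul, map_mul, φ'_x, x_mul]

/-- Replace each `ω_l` by its image. The chain in `R_{n+1}` could have one more term, at `l = n+1`,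
but the condition `i < r` puts the factor `x_r - x_r` in its coefficient. The induction is on `r - i
- 1`, starting at `i + 1 = r`, where this factor truncates the recursion. -/
theorem φ'_chain (i r : ℕ) (hr : r < n) (hir : i < r) :
    φ' (chain (MvPolynomial.X ⟨r, hr⟩) ⟨i, by omega⟩ : R k n) =
      chain (MvPolynomial.X ⟨r, by omega⟩) ⟨i, by omega⟩ -
        (MvPolynomial.X (Fin.last n) : Pol k (n + 1)) •
          chainOf (MvPolynomial.X ⟨r, by omega⟩) (chain (MvPolynomial.X (Fin.last n)))
            ⟨i, by omega⟩ := by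
  obtain ⟨m, rfl⟩ := Nat.exists_eq_add_of_lt hir
  induction m generalizing i with
  | zero =>
    rw [chain_succ _ i (by omega), chain_succ _ i (by omega), chainOf_succ _ _ i (by omega)]
    simp only [add_zero, sub_self, map_zero, zero_mul, zero_smul, φ'_ω, φω_eq_chain]
    rfl
  | succ m ih =>
    have e : i + (m + 1) + 1 = i + 1 + m + 1 := by omega
    simp only [e] at hr ⊢
    rw [chain_succ _ i (by omega), chain_succ _ i (by omega), chainOf_succ _ _ i (by omega),
      ← smul_eq_pol_mul, ← smul_eq_pol_mul, map_add, sub_smul, map_sub, φ'_X_smul, φ'_X_smul,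
      ih (i + 1) hr (by omega), φ'_ω, φω_eq_chain]
    simp only [Fin.castSucc_mk]
    module

/-- In `d(ω_i - x_{n+1} U_i)` the term `-x_{n+1}² U_i` cancels the summand `r = n+1` of `d(ω_i)`.
What remains are the summands `r ≤ n`, matched term by term through `φ'_chain` and `d_chain`. -/
theorem φ'_dω (i : Fin n) : φ' (dω i : R k n) = d (φω i) := by
  have h : φ' (dω i : R k n) = ∑ r ∈ Finset.Ioi i,
      (MvPolynomial.X r.castSucc ^ 2 : Pol k (n + 1)) •
        (chain (MvPolynomial.X r.castSucc) i.castSucc -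
          (MvPolynomial.X (Fin.last n) : Pol k (n + 1)) •
            chainOf (MvPolynomial.X r.castSucc) (chain (MvPolynomial.X (Fin.last n)))
              i.castSucc) := by
    rw [dω_eq_chain, map_sum]
    refine Finset.sum_congr rfl fun r hr => ?_
    have := φ'_chain (k := k) i.val r.val r.isLt (Fin.lt_def.mp (Finset.mem_Ioi.mp hr))
    rw [map_mul, map_pow, φ'_x, x_sq_mul]
    exact congrArg _ this
  have h' := d_chain (k := k) (Fin.last n) i.castSucc
  -- The summand `r = n+1` equals the extra term on the left of `d_chain`.
  rw [sum_Ioi_castSucc, add_right_cancel_iff] at h'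
  rw [h, φω_eq_chain, map_sub, d_ω, dω_castSucc, d_X_smul, h']
  simp only [smul_sub, Finset.sum_sub_distrib, smul_comm _ (MvPolynomial.X (Fin.last n)),
    ← Finset.smul_sum]
  abel

theorem φ'_d (f : R k n) : φ' (d f) = d (φ' f) := by
  induction f using gen_induction with
  | hc c => rw [d_algebraMap, AlgHom.commutes, d_algebraMap, map_zero]
  | hx i => rw [d_x, map_pow, φ'_x, d_x]
  | hω i => rw [d_ω, φ'_ω, φ'_dω]
  | hadd f g hf hg => simp only [map_add, hf, hg]
  | hmul f g hf hg => simp only [d_mul, map_add, map_mul, hf, hg]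

/-! ### Equivariance -/

theorem swap_castSucc (j : ℕ) (hj : j + 1 < n) (i : Fin n) :
    swap j (hj.trans n.lt_succ_self) i.castSucc = (swap j hj i).castSucc := by
  simp only [swap, Equiv.swap_apply_def, Fin.ext_iff, Fin.val_castSucc]
  split_ifs <;> simp

theorem swap_last (j : ℕ) (hj : j + 1 < n) :
    swap j (hj.trans n.lt_succ_self) (Fin.last n) = Fin.last n :=
  swap_ne j _ _ (by simp; omega) (by simp; omega)

theorem s_smul (j : ℕ) (hj : j + 1 < n) (p : Pol k n) (f : R k n) :
    s j hj (p • f) = MvPolynomial.rename (swap j hj) p • s j hj f := by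
  rw [smul_eq_pol_mul, smul_eq_pol_mul, map_mul, s_pol]

/-- For `i = j`, one step of the recursion gives `s_i(U_i) = U_i + (x_i - x_{i+1}) U_{i+1}`, since
`s_i` fixes `ω_{i+1}`, `U_{i+1}` and `x_{n+1}`. So `U_i` transforms by the same rule as `ω_i`. For
`i ≠ j` both are fixed. -/
theorem s_φω (j : ℕ) (hj : j + 1 < n) (i : Fin n) :
    s j (hj.trans n.lt_succ_self) (φω i : R k (n + 1)) = φ' (sω j hj i) := by
  by_cases h : i.val = j
  · obtain ⟨i, hi⟩ := i
    simp only at h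
    subst h
    have e : swap i (hj.trans n.lt_succ_self) ⟨i + 1, by omega⟩ = ⟨i, by omega⟩ :=
      Equiv.swap_apply_right _ _
    rw [sω, if_pos rfl, map_add, map_mul, map_sub, φ'_ω, φ'_x, φ'_x, φ'_ω, φω_eq_chain,
      φω_eq_chain, map_sub, s_smul, MvPolynomial.rename_X, swap_last i hj, s_ω, sω,
      if_pos (by simp)]
    simp only [Fin.castSucc_mk]
    rw [chain_succ _ i (by omega), map_add, map_mul, s_pol, s_ω_ne _ _ _ (by simp),
      s_chain _ _ _ _ (by simp), map_sub]
    simp only [MvPolynomial.rename_X, swap_last i hj, e, sub_mul, x_mul, ← smul_eq_pol_mul]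
    module
  · rw [sω, if_neg h, add_zero, φ'_ω, φω_eq_chain, map_sub, s_smul, MvPolynomial.rename_X,
      swap_last j hj, s_chain _ _ _ _ (by simpa using h), MvPolynomial.rename_X, swap_last j hj,
      s_ω_ne _ _ _ (by simpa using h)]

theorem s_φ' (j : ℕ) (hj : j + 1 < n) (f : R k n) :
    s j (hj.trans n.lt_succ_self) (φ' f) = φ' (s j hj f) := by
  induction f using gen_induction with
  | hc c => simp only [AlgHom.commutes]
  | hx i => rw [φ'_x, s_x, s_x, φ'_x, swap_castSucc]
  | hω i => rw [φ'_ω, s_φω, s_ω]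
  | hadd f g hf hg => simp only [map_add, hf, hg]
  | hmul f g hf hg => simp only [map_mul, hf, hg]

/-! ### Gradings -/

theorem mem_of_bidegree_eq {V : Type*} [AddCommMonoid V] [Module k V] (M : ℤ → ℤ → Submodule k V)
    {s t s' t' : ℤ} {f : V} (hf : f ∈ M s t) (hs : s = s') (ht : t = t') : f ∈ M s' t' :=
  hs ▸ ht ▸ hf

theorem one_mem_grading : (1 : R k n) ∈ grading k n 0 0 :=
  Submodule.subset_span ⟨0, [], by simp, by simp, by simp⟩

theorem x_mem_grading (i : Fin n) : (x i : R k n) ∈ grading k n 2 0 :=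
  Submodule.subset_span ⟨Finsupp.single i 1, [], by simp [x, MvPolynomial.X],
    by simp [Finsupp.single_apply], by simp⟩

theorem ω_mem_grading (i : Fin n) : (ω i : R k n) ∈ grading k n (-2 * (i.val + 1)) 2 :=
  Submodule.subset_span ⟨0, [i], by simp, by simp, by simp⟩

theorem grading_mul {s t s' t' : ℤ} {f g : R k n} (hf : f ∈ grading k n s t)
    (hg : g ∈ grading k n s' t') : f * g ∈ grading k n (s + s') (t + t') := by
  have h : grading k n s t * grading k n s' t' ≤ grading k n (s + s') (t + t') := by
    rw [grading, grading, Submodule.span_mul_span, Submodule.span_le]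
    rintro _ ⟨_, ⟨e, L, rfl, rfl, rfl⟩, _, ⟨e', L', rfl, rfl, rfl⟩, rfl⟩
    refine Submodule.subset_span ⟨e + e', L ++ L', ?_, ?_, ?_⟩
    · have : (MvPolynomial.monomial (e + e') 1 : Pol k n) =
          MvPolynomial.monomial e 1 * MvPolynomial.monomial e' 1 := by
        rw [MvPolynomial.monomial_mul, one_mul]
      simp only [this, map_mul, List.map_append, List.prod_append, mul_assoc]
      congr 1
      rw [← mul_assoc, ← mul_assoc, pol_comm]
    · simp only [Finsupp.add_apply, Nat.cast_add, Finset.sum_add_distrib, List.map_append,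
        List.sum_append]
      ring
    · simp only [List.length_append, Nat.cast_add]
      ring
  exact h (Submodule.mul_mem_mul hf hg)

theorem pow_mem_of_graded {B : Type*} [Ring B] [Algebra k B] (M : ℤ → ℤ → Submodule k B)
    (h1 : 1 ∈ M 0 0)
    (hmul : ∀ s t s' t' f g, f ∈ M s t → g ∈ M s' t' → f * g ∈ M (s + s') (t + t'))
    {s t : ℤ} {f : B} (hf : f ∈ M s t) (a : ℕ) : f ^ a ∈ M (a * s) (a * t) := by
  induction a with
  | zero => simpa using h1
  | succ a ih =>
    rw [pow_succ]
    exact mem_of_bidegree_eq M (hmul _ _ _ _ _ _ ih hf) (by push_cast; ring) (by push_cast; ring)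

/-- An algebra map which is homogeneous on the generators is homogeneous. -/
theorem map_mem_of_generators {B : Type*} [Ring B] [Algebra k B] (M : ℤ → ℤ → Submodule k B)
    (h1 : 1 ∈ M 0 0)
    (hmul : ∀ s t s' t' f g, f ∈ M s t → g ∈ M s' t' → f * g ∈ M (s + s') (t + t'))
    (h : R k n →ₐ[k] B) (hx : ∀ i, h (x i) ∈ M 2 0)
    (hω : ∀ i, h (ω i) ∈ M (-2 * (i.val + 1)) 2) {s t : ℤ} {f : R k n}
    (hf : f ∈ grading k n s t) : h f ∈ M s t := by
  have hlist : ∀ L : List (Fin n), h (L.map ω).prod ∈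
      M (-2 * (L.map fun i => (i.val : ℤ) + 1).sum) (2 * L.length) := by
    intro L
    induction L with
    | nil => simpa using h1
    | cons i L ih =>
      simp only [List.map_cons, List.prod_cons, map_mul, List.sum_cons, List.length_cons]
      exact mem_of_bidegree_eq M (hmul _ _ _ _ _ _ (hω i) ih) (by ring) (by push_cast; ring)
  have hmon : ∀ e : Fin n →₀ ℕ, h (pol (MvPolynomial.monomial e 1)) ∈
      M (2 * ∑ i, (e i : ℤ)) 0 := by
    intro e
    induction e using Finsupp.induction_linear with
    | zero => simpa using h1
    | add e e' he he' =>
      have : (MvPolynomial.monomial (e + e') 1 : Pol k n) =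
          MvPolynomial.monomial e 1 * MvPolynomial.monomial e' 1 := by
        rw [MvPolynomial.monomial_mul, one_mul]
      rw [this, map_mul, map_mul]
      refine mem_of_bidegree_eq M (hmul _ _ _ _ _ _ he he') ?_ (by ring)
      simp only [Finsupp.add_apply, Nat.cast_add, Finset.sum_add_distrib]
      ring
    | single i a =>
      rw [← MvPolynomial.X_pow_eq_monomial, map_pow, map_pow]
      exact mem_of_bidegree_eq M (pow_mem_of_graded M h1 hmul (hx i) a)
        (by simp [Finsupp.single_apply, mul_comm]) (by simp)
  refine Submodule.span_le (p := (M s t).comap h.toLinearMap).mpr ?_ hf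
  rintro _ ⟨e, L, rfl, rfl, rfl⟩
  change h _ ∈ M _ _
  rw [map_mul]
  exact mem_of_bidegree_eq M (hmul _ _ _ _ _ _ (hmon e) (hlist L)) (by ring) (by ring)

theorem span_grading_eq_top :
    Submodule.span k {f : R k n | ∃ s t, f ∈ grading k n s t} = ⊤ := by
  rw [eq_top_iff]
  rintro f -
  induction f using gen_induction with
  | hc c =>
    rw [Algebra.algebraMap_eq_smul_one]
    exact Submodule.smul_mem _ _ (Submodule.subset_span ⟨_, _, one_mem_grading⟩)
  | hx i => exact Submodule.subset_span ⟨_, _, x_mem_grading i⟩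
  | hω i => exact Submodule.subset_span ⟨_, _, ω_mem_grading i⟩
  | hadd f g hf hg => exact add_mem hf hg
  | hmul f g hf hg =>
    have := Submodule.mul_mem_mul hf hg
    rw [Submodule.span_mul_span] at this
    refine Submodule.span_mono ?_ this
    rintro _ ⟨f, ⟨s, t, hf⟩, g, ⟨s', t', hg⟩, rfl⟩
    exact ⟨_, _, grading_mul hf hg⟩

theorem prod_mem_grading (i l : Fin n) (hil : i < l) (t : Pol k n)
    (ht : pol t ∈ grading k n 2 0) :
    (pol (∏ m ∈ Finset.Ioo i l, (MvPolynomial.X m - t)) : R k n) ∈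
      grading k n (2 * (l.val - i.val - 1)) 0 := by
  have key : ∀ s : Finset (Fin n), (pol (∏ m ∈ s, (MvPolynomial.X m - t)) : R k n) ∈
      grading k n (2 * s.card) 0 := by
    intro s
    induction s using Finset.induction_on with
    | empty => simpa using one_mem_grading
    | insert a s ha ih =>
      rw [Finset.prod_insert ha, map_mul, Finset.card_insert_of_notMem ha, map_sub]
      exact mem_of_bidegree_eq _ (grading_mul (sub_mem (x_mem_grading a) ht) ih)
        (by push_cast; ring) (by ring)
  refine mem_of_bidegree_eq _ (key _) ?_ rfl
  rw [Fin.card_Ioo]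
  rw [Fin.lt_def] at hil
  omega

/-- The degree `2(l - i - 1)` of the coefficient compensates the dependence of `deg ω_l` on `l`, so
all summands have the same bidegree. -/
theorem chain_mem_grading (t : Pol k n) (ht : pol t ∈ grading k n 2 0) (i : Fin n) :
    (chain t i : R k n) ∈ grading k n (-2 * (i.val + 2)) 2 := by
  refine Submodule.sum_mem _ fun l hl => ?_
  exact mem_of_bidegree_eq _ (grading_mul (prod_mem_grading i l (Finset.mem_Ioi.mp hl) t ht)
    (ω_mem_grading l)) (by ring) (by ring)

theorem φ'_mem_grading {s t : ℤ} {f : R k n} (hf : f ∈ grading k n s t) :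
    φ' f ∈ grading k (n + 1) s t := by
  refine map_mem_of_generators _ one_mem_grading (fun _ _ _ _ _ _ => grading_mul) φ'
    (fun i => ?_) (fun i => ?_) hf
  · rw [φ'_x]; exact x_mem_grading _
  · rw [φ'_ω, φω_eq_chain, ← x_mul]
    refine sub_mem (mem_of_bidegree_eq _ (ω_mem_grading i.castSucc)
      (by rw [Fin.val_castSucc]) rfl) ?_
    exact mem_of_bidegree_eq _ (grading_mul (x_mem_grading (Fin.last n))
      (chain_mem_grading (MvPolynomial.X (Fin.last n)) (x_mem_grading (Fin.last n)) i.castSucc))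
      (by simp only [Fin.val_castSucc]; ring) (by ring)

/-! ### The parity automorphism -/

/-- The automorphism of `R_n` which fixes the `x_i` and changes the sign of the `ω_i`. -/
def parity : R k n →ₐ[k] R k n :=
  lift x (fun i => -ω i) (fun _ _ => pol_comm _ _) (fun i => by rw [neg_mul_neg, ω_sq])
    (fun i j => by rw [neg_mul_neg, neg_mul_neg, ω_anticomm])

theorem parity_x (i : Fin n) : parity (x i : R k n) = x i := lift_x _ _ _ _ _ i

theorem parity_ω (i : Fin n) : parity (ω i : R k n) = -ω i := lift_ω _ _ _ _ _ i

theorem parity_mem_grading {s t : ℤ} {f : R k n} (hf : f ∈ grading k n s t) :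
    parity f ∈ grading k n s t := by
  refine map_mem_of_generators _ one_mem_grading (fun _ _ _ _ _ _ => grading_mul) parity
    (fun i => ?_) (fun i => ?_) hf
  · rw [parity_x]; exact x_mem_grading _
  · rw [parity_ω]; exact neg_mem (ω_mem_grading _)

theorem s_parity (j : ℕ) (hj : j + 1 < n) (f : R k n) :
    s j hj (parity f) = parity (s j hj f) := by
  induction f using gen_induction with
  | hc c => simp only [AlgHom.commutes]
  | hx i => rw [parity_x, s_x, parity_x]
  | hω i =>
    rw [parity_ω, map_neg, s_ω, sω]
    split_ifs
    · simp only [map_add, map_mul, map_sub, parity_x, parity_ω]; noncomm_ring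
    · rw [add_zero, parity_ω]
  | hadd f g hf hg => simp only [map_add, hf, hg]
  | hmul f g hf hg => simp only [map_mul, hf, hg]

theorem parity_mem_invariants {f : R k n} (hf : f ∈ invariants k n) :
    parity f ∈ invariants k n := fun j hj => by rw [s_parity, hf j hj]

theorem parity_iterate_mem_invariants {f : R k n} (hf : f ∈ invariants k n) (e : ℕ) :
    parity^[e] f ∈ invariants k n := by
  induction e with
  | zero => exact hf
  | succ e ih => rw [Function.iterate_succ_apply']; exact parity_mem_invariants ih

theorem parity_iterate_mem_grading {s t : ℤ} {f : R k n} (hf : f ∈ grading k n s t) (e : ℕ) :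
    parity^[e] f ∈ grading k n s t := by
  induction e with
  | zero => exact hf
  | succ e ih => rw [Function.iterate_succ_apply']; exact parity_mem_grading ih

/-- On generators: `φ'(x_i)` is central, and `φ'(ω_i)` is a linear form, hence anticommutes with
`ω_{n+1}`. -/
theorem ω_last_mul_φ' (f : R k n) : ω (Fin.last n) * φ' f = φ' (parity f) * ω (Fin.last n) := by
  induction f using gen_induction with
  | hc c => simp only [AlgHom.commutes, Algebra.commutes]
  | hx i => rw [parity_x, φ'_x]; exact (pol_comm _ _).symm
  | hω i =>
    rw [parity_ω, map_neg, neg_mul, ← add_eq_zero_iff_eq_neg, φ'_ω]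
    exact linearForms_anticomm (ω_mem_linearForms _) (φω_mem_linearForms i)
  | hadd f g hf hg => simp only [map_add, mul_add, add_mul, hf, hg]
  | hmul f g hf hg => rw [map_mul, map_mul, map_mul, ← mul_assoc, hf, mul_assoc, hg, mul_assoc]

/-! ### The decomposition of `R_{n+1}` over `R_n` -/

/-- The elements `x_{n+1}^a ω_{n+1}^e` of `R_{n+1}`. -/
def lastMonomial (k : Type u) [CommRing k] (n a e : ℕ) : R k (n + 1) :=
  x (Fin.last n) ^ a * ω (Fin.last n) ^ e

theorem x_pow_mul_comm (i : Fin n) (a : ℕ) (f : R k n) : x i ^ a * f = f * x i ^ a := by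
  rw [x, ← map_pow]; exact pol_comm _ _

theorem ω_pow_eq_zero (i : Fin n) {e : ℕ} (he : 2 ≤ e) : (ω i ^ e : R k n) = 0 :=
  pow_eq_zero_of_le he (by rw [sq, ω_sq])

theorem lastMonomial_mul (a e a' e' : ℕ) :
    lastMonomial k n a e * lastMonomial k n a' e' = lastMonomial k n (a + a') (e + e') := by
  rw [lastMonomial, lastMonomial, lastMonomial, mul_assoc, ← mul_assoc (ω _ ^ e),
    ← x_pow_mul_comm, pow_add, pow_add]
  simp only [mul_assoc]

theorem lastMonomial_mul_φ' (a e : ℕ) (f : R k n) :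
    lastMonomial k n a e * φ' f = φ' (parity^[e] f) * lastMonomial k n a e := by
  have h : ∀ f : R k n, ω (Fin.last n) ^ e * φ' f =
      φ' (parity^[e] f) * ω (Fin.last n) ^ e := by
    induction e with
    | zero => simp
    | succ e ih =>
      intro f
      rw [pow_succ, mul_assoc, ω_last_mul_φ', ← mul_assoc, ih, mul_assoc,
        ← Function.iterate_succ_apply]
  rw [lastMonomial, mul_assoc, h, ← mul_assoc, x_pow_mul_comm, mul_assoc]

theorem φ'_mul_lastMonomial_mul (f g : R k n) (a e a' e' : ℕ) :
    φ' f * lastMonomial k n a e * (φ' g * lastMonomial k n a' e') =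
      φ' (f * parity^[e] g) * lastMonomial k n (a + a') (e + e') := by
  rw [mul_assoc, ← mul_assoc (lastMonomial k n a e), lastMonomial_mul_φ', map_mul,
    ← lastMonomial_mul]
  simp only [mul_assoc]

/-- The exponent of `ω_{n+1}` ranges over all naturals, so that products keep their shape without
case distinctions; this discards the superfluous ones. -/
theorem lastMonomial_eq_zero (a : ℕ) {e : ℕ} (he : 2 ≤ e) : lastMonomial k n a e = 0 := by
  rw [lastMonomial, ω_pow_eq_zero _ he, mul_zero]

theorem lastMonomial_zero : lastMonomial k n 0 0 = 1 := by simp [lastMonomial]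

theorem s_lastMonomial (j : ℕ) (hj : j + 1 < n) (a e : ℕ) :
    s j (hj.trans n.lt_succ_self) (lastMonomial k n a e) = lastMonomial k n a e := by
  rw [lastMonomial, map_mul, map_pow, map_pow, s_x, swap_last j hj,
    s_ω_ne _ _ _ (by simp; omega)]

theorem lastMonomial_mem_grading (a e : ℕ) :
    lastMonomial k n a e ∈ grading k (n + 1) (2 * a - 2 * (n + 1) * e) (2 * e) := by
  refine mem_of_bidegree_eq _ (grading_mul
    (pow_mem_of_graded _ one_mem_grading (fun _ _ _ _ _ _ => grading_mul)
      (x_mem_grading (k := k) (Fin.last n)) a)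
    (pow_mem_of_graded _ one_mem_grading (fun _ _ _ _ _ _ => grading_mul)
      (ω_mem_grading (k := k) (Fin.last n)) e)) ?_ ?_
  · simp only [Fin.val_last]; ring
  · ring

/-- The span of the `φ'(f) x_{n+1}^a ω_{n+1}^e` of bidegree `(s, t)`, with `f` homogeneous. -/
def decomposed (k : Type u) [CommRing k] (n : ℕ) (s t : ℤ) : Submodule k (R k (n + 1)) :=
  Submodule.span k {g | ∃ (f : R k n) (a e : ℕ) (s' t' : ℤ), f ∈ grading k n s' t' ∧
    g = φ' f * lastMonomial k n a e ∧ s = s' + (2 * a - 2 * (n + 1) * e) ∧ t = t' + 2 * e}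

theorem φ'_mem_decomposed {s t : ℤ} {f : R k n} (hf : f ∈ grading k n s t) :
    φ' f ∈ decomposed k n s t :=
  Submodule.subset_span ⟨f, 0, 0, s, t, hf, by rw [lastMonomial_zero, mul_one], by simp, by simp⟩

theorem lastMonomial_mem_decomposed (a e : ℕ) :
    lastMonomial k n a e ∈ decomposed k n (2 * a - 2 * (n + 1) * e) (2 * e) :=
  Submodule.subset_span ⟨1, a, e, 0, 0, one_mem_grading, by rw [map_one, one_mul],
    by rw [zero_add], by rw [zero_add]⟩

theorem decomposed_mul (s t s' t' : ℤ) (f g : R k (n + 1)) (hf : f ∈ decomposed k n s t)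
    (hg : g ∈ decomposed k n s' t') : f * g ∈ decomposed k n (s + s') (t + t') := by
  have h : decomposed k n s t * decomposed k n s' t' ≤ decomposed k n (s + s') (t + t') := by
    rw [decomposed, decomposed, Submodule.span_mul_span, Submodule.span_le]
    rintro _ ⟨_, ⟨f, a, e, p, q, hp, rfl, rfl, rfl⟩, _, ⟨f', a', e', p', q', hp', rfl, rfl, rfl⟩,
      rfl⟩
    refine Submodule.subset_span ⟨_, _, _, _, _,
      grading_mul hp (parity_iterate_mem_grading hp' e), φ'_mul_lastMonomial_mul _ _ _ _ _ _, ?_, ?_⟩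
    · push_cast; ring
    · push_cast; ring
  exact h (Submodule.mul_mem_mul hf hg)

theorem x_mem_decomposed (i : Fin (n + 1)) : (x i : R k (n + 1)) ∈ decomposed k n 2 0 := by
  induction i using Fin.lastCases with
  | last => simpa [lastMonomial] using lastMonomial_mem_decomposed (k := k) (n := n) 1 0
  | cast i => rw [← φ'_x]; exact φ'_mem_decomposed (x_mem_grading i)

theorem one_mem_decomposed : (1 : R k (n + 1)) ∈ decomposed k n 0 0 := by
  simpa using φ'_mem_decomposed (one_mem_grading (k := k) (n := n))

/-- The two claims feed each other in a downward induction: `U_i = ω_{i+1} + (x_{i+1} - x_{n+1})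
U_{i+1}`, and then `ω_i = φ'(ω_i) + x_{n+1} U_i`. -/
theorem chain_mem_decomposed_and_ω_mem_decomposed (i : Fin (n + 1)) :
    (chain (MvPolynomial.X (Fin.last n)) i : R k (n + 1)) ∈
        decomposed k n (-2 * (i.val + 2)) 2 ∧
      (ω i : R k (n + 1)) ∈ decomposed k n (-2 * (i.val + 1)) 2 := by
  induction i using Fin.reverseInduction with
  | last =>
    refine ⟨by rw [chain_last_eq_zero]; exact zero_mem _, ?_⟩
    have h := lastMonomial_mem_decomposed (k := k) (n := n) 0 1
    rw [lastMonomial, pow_zero, pow_one, one_mul] at h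
    exact mem_of_bidegree_eq _ h (by simp) (by simp)
  | cast i ih =>
    obtain ⟨h1, h2⟩ := ih
    have hU : (chain (MvPolynomial.X (Fin.last n)) i.castSucc : R k (n + 1)) ∈
        decomposed k n (-2 * (i.val + 2)) 2 := by
      rw [chain_castSucc, sub_smul, ← x_mul, ← x_mul, ← sub_mul]
      refine add_mem ?_ ?_
      · exact mem_of_bidegree_eq _ h2 (by simp only [Fin.val_succ]; push_cast; ring) rfl
      · exact mem_of_bidegree_eq _ (decomposed_mul _ _ _ _ _ _
          (sub_mem (x_mem_decomposed i.succ) (x_mem_decomposed (Fin.last n))) h1)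
          (by simp only [Fin.val_succ]; push_cast; ring) (by ring)
    refine ⟨hU, ?_⟩
    have : (ω i.castSucc : R k (n + 1)) = φ' (ω i) +
        x (Fin.last n) * chain (MvPolynomial.X (Fin.last n)) i.castSucc := by
      rw [φ'_ω, φω_eq_chain, x_mul, sub_add_cancel]
    rw [this]
    refine add_mem (φ'_mem_decomposed (ω_mem_grading i)) ?_
    exact mem_of_bidegree_eq _ (decomposed_mul _ _ _ _ _ _ (x_mem_decomposed (Fin.last n)) hU)
      (by simp only [Fin.val_castSucc]; ring) (by ring)

/-- `decomposed` is multiplicative and contains the generators in their bidegrees, so the criterion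
for algebra maps applies to the identity. Keeping track of bidegrees is what later gives homogeneity
of `φ`. -/
theorem grading_le_decomposed (s t : ℤ) : grading k (n + 1) s t ≤ decomposed k n s t := fun _ hf =>
  map_mem_of_generators (decomposed k n) one_mem_decomposed decomposed_mul (AlgHom.id k _)
    x_mem_decomposed (fun i => (chain_mem_decomposed_and_ω_mem_decomposed i).2) hf

/-- The map `(f_{a,e}) ↦ ∑ φ'(f_{a,e}) x_{n+1}^a ω_{n+1}^e`. -/
def assemble (k : Type u) [CommRing k] (n : ℕ) : (ℕ × Fin 2 →₀ R k n) →ₗ[k] R k (n + 1) :=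
  Finsupp.lsum k fun p => LinearMap.mulRight k (lastMonomial k n p.1 p.2) ∘ₗ φ'.toLinearMap

theorem assemble_single (p : ℕ × Fin 2) (f : R k n) :
    assemble k n (Finsupp.single p f) = φ' f * lastMonomial k n p.1 p.2 := by
  rw [assemble, Finsupp.lsum_single]; rfl

theorem assemble_surjective : Function.Surjective (assemble k n) := by
  rw [← LinearMap.range_eq_top, eq_top_iff, ← span_grading_eq_top, Submodule.span_le]
  rintro f ⟨s, t, hf⟩
  refine (Submodule.span_le (p := LinearMap.range (assemble k n))).mpr ?_
    (grading_le_decomposed s t hf)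
  rintro _ ⟨f, a, e, -, -, -, rfl, -, -⟩
  by_cases he : e < 2
  · exact ⟨Finsupp.single (a, ⟨e, he⟩) f, assemble_single _ _⟩
  · rw [lastMonomial_eq_zero a (not_lt.mp he), mul_zero]; exact zero_mem _

/-! ### Independence of the monomials in `x_{n+1}` and `ω_{n+1}` over `φ'(R_n)` -/

theorem ω_add_chain_mem_linearForms (i : Fin (n + 1)) :
    ω i + (MvPolynomial.X (Fin.last n) : Pol k (n + 1)) • chain 0 i ∈ linearForms k (n + 1) :=
  add_mem (ω_mem_linearForms i) (Submodule.smul_mem _ _ (chain_mem_linearForms 0 i))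

/-- The map `R_{n+1} → R_{n+1}` with `x_i ↦ x_i` and
`ω_i ↦ ω_i + x_{n+1} ∑_{l>i} ∏_{i<m<l} x_m ω_l`. -/
def untwist : R k (n + 1) →ₐ[k] R k (n + 1) :=
  lift x (fun i => ω i + (MvPolynomial.X (Fin.last n) : Pol k (n + 1)) • chain 0 i)
    (fun _ _ => pol_comm _ _) (fun i => linearForms_sq (ω_add_chain_mem_linearForms i))
    (fun i j => linearForms_anticomm (ω_add_chain_mem_linearForms i)
      (ω_add_chain_mem_linearForms j))

theorem untwist_x (i : Fin (n + 1)) : untwist (x i : R k (n + 1)) = x i := lift_x _ _ _ _ _ i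

theorem untwist_ω (i : Fin (n + 1)) : untwist (ω i : R k (n + 1)) =
    ω i + (MvPolynomial.X (Fin.last n) : Pol k (n + 1)) • chain 0 i := lift_ω _ _ _ _ _ i

/-- In the recursion the term `x_{n+1} chain 0 (i+1)` from the image of `ω_{i+1}` cancels the
`-x_{n+1}` in the coefficient. Consequently `untwist` undoes the correction in `φω`, and `untwist ∘
φ'` is the standard inclusion on generators. -/
theorem untwist_chain (i : Fin (n + 1)) :
    untwist (chain (MvPolynomial.X (Fin.last n)) i : R k (n + 1)) = chain 0 i := by
  induction i using Fin.reverseInduction with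
  | last => rw [chain_last_eq_zero, chain_last_eq_zero, map_zero]
  | cast i ih =>
    rw [chain_castSucc, chain_castSucc, map_add, sub_smul, ← x_mul, ← x_mul, map_sub, map_mul,
      map_mul, untwist_x, untwist_x, ih, untwist_ω, x_mul, x_mul]
    module

theorem untwist_φω (i : Fin n) : untwist (φω i : R k (n + 1)) = ω i.castSucc := by
  rw [φω_eq_chain, ← x_mul, map_sub, map_mul, untwist_x, untwist_chain, untwist_ω, x_mul,
    add_sub_cancel_right]

/-- The representation of `R_{n+1}` by matrices over `R_n[X]` given by the action of `R_{n+1}`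
from the right on `R_n[X] ⊕ R_n[X] ω_{n+1}`. -/
def matrixRep : R k (n + 1) →ₐ[k] Matrix (Fin 2) (Fin 2) (Polynomial (R k n)) :=
  lift
    (fun i => Matrix.scalar (Fin 2)
      (Fin.lastCases (motive := fun _ => Polynomial (R k n))
        Polynomial.X (fun i => Polynomial.C (x i)) i))
    (fun i => Fin.lastCases (motive := fun _ => Matrix (Fin 2) (Fin 2) (Polynomial (R k n)))
      -- Row `a` holds the coordinates of the `a`-th element of the basis `1, ω_{n+1}` multiplied
      -- from the right; the sign is that of `ω_{n+1} ω_i = -ω_i ω_{n+1}`.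
      !![0, 1; 0, 0] (fun i => !![Polynomial.C (ω i), 0; 0, -Polynomial.C (ω i)]) i)
    (fun i M => by
      refine (Matrix.scalar_commute _ (fun r => ?_) M).eq
      induction i using Fin.lastCases with
      | last => simpa using Polynomial.commute_X r
      | cast i =>
        simp only [Fin.lastCases_castSucc]
        refine Polynomial.ext fun m => ?_
        rw [Polynomial.coeff_C_mul, Polynomial.coeff_mul_C]
        exact pol_comm _ _)
    (fun i => by
      refine Matrix.ext fun a b => ?_
      induction i using Fin.lastCases with
      | last => fin_cases a <;> fin_cases b <;> simp
      | cast i =>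
        have h : (Polynomial.C (ω i) * Polynomial.C (ω i) : Polynomial (R k n)) = 0 := by
          rw [← Polynomial.C_mul, ω_sq, Polynomial.C_0]
        fin_cases a <;> fin_cases b <;> simp [h])
    (fun i j => by
      refine Matrix.ext fun a b => ?_
      induction i using Fin.lastCases with
      | last =>
        induction j using Fin.lastCases with
        | last => fin_cases a <;> fin_cases b <;> simp
        | cast j => fin_cases a <;> fin_cases b <;> simp
      | cast i =>
        induction j using Fin.lastCases with
        | last => fin_cases a <;> fin_cases b <;> simp
        | cast j =>
          have h : (Polynomial.C (ω i) * Polynomial.C (ω j) +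
              Polynomial.C (ω j) * Polynomial.C (ω i) : Polynomial (R k n)) = 0 := by
            rw [← Polynomial.C_mul, ← Polynomial.C_mul, ← Polynomial.C_add, ω_anticomm,
              Polynomial.C_0]
          fin_cases a <;> fin_cases b <;> simp [h])

theorem matrixRep_x_last : matrixRep (x (Fin.last n) : R k (n + 1)) =
    Matrix.scalar (Fin 2) Polynomial.X := by
  rw [matrixRep, lift_x, Fin.lastCases_last]

theorem matrixRep_ω_last : matrixRep (ω (Fin.last n) : R k (n + 1)) = !![0, 1; 0, 0] := by
  rw [matrixRep, lift_ω, Fin.lastCases_last]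

theorem matrixRep_x_castSucc (i : Fin n) : matrixRep (x i.castSucc : R k (n + 1)) =
    Matrix.scalar (Fin 2) (Polynomial.C (x i)) := by
  rw [matrixRep, lift_x, Fin.lastCases_castSucc]

theorem matrixRep_ω_castSucc (i : Fin n) : matrixRep (ω i.castSucc : R k (n + 1)) =
    !![Polynomial.C (ω i), 0; 0, -Polynomial.C (ω i)] := by
  rw [matrixRep, lift_ω, Fin.lastCases_castSucc]

/-- Only the first row is considered, since the second one carries the parity twist. The arbitrary
factor `M` makes the product step of the induction close. -/
theorem matrixRep_untwist_φ' (f : R k n) (M : Matrix (Fin 2) (Fin 2) (Polynomial (R k n))) :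
    (matrixRep (untwist (φ' f)) * M) 0 = Polynomial.C f • M 0 := by
  induction f using gen_induction generalizing M with
  | hc c =>
    rw [AlgHom.commutes, AlgHom.commutes, AlgHom.commutes, ← Algebra.smul_def]
    ext1 j
    simp only [Matrix.smul_apply, Pi.smul_apply, smul_eq_mul, Algebra.smul_def]
    rfl
  | hx i =>
    rw [φ'_x, untwist_x, matrixRep_x_castSucc]
    ext1 j
    simp [Matrix.mul_apply, Fin.sum_univ_two]
  | hω i =>
    rw [φ'_ω, untwist_φω, matrixRep_ω_castSucc]
    ext1 j
    simp [Matrix.mul_apply, Fin.sum_univ_two]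
  | hadd f g hf hg =>
    rw [map_add, map_add, map_add, add_mul, map_add, add_smul, ← hf, ← hg]
    rfl
  | hmul f g hf hg =>
    rw [map_mul, map_mul, map_mul, mul_assoc, hf, hg, smul_smul, map_mul]

theorem matrixRep_untwist_lastMonomial (a : ℕ) (e j : Fin 2) :
    matrixRep (untwist (lastMonomial k n a e)) 0 j = if e = j then Polynomial.X ^ a else 0 := by
  rw [lastMonomial, map_mul, map_pow, map_pow, untwist_x, untwist_ω, chain_last_eq_zero, smul_zero,
    add_zero, map_mul, map_pow, map_pow, matrixRep_x_last, matrixRep_ω_last, ← map_pow,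
    Matrix.scalar_apply, Matrix.diagonal_mul]
  fin_cases e <;> fin_cases j <;> simp

/-- The first row represents the product of `1` with the given element, so its entries are the
coordinates. This is an explicit left inverse of `assemble`. -/
theorem coeff_matrixRep_untwist_assemble (w : ℕ × Fin 2 →₀ R k n) (p : ℕ × Fin 2) :
    (matrixRep (untwist (assemble k n w)) 0 p.2).coeff p.1 = w p := by
  induction w using Finsupp.induction_linear with
  | zero => simp
  | add w w' hw hw' => simp only [map_add, Matrix.add_apply, Polynomial.coeff_add, hw, hw',
      Finsupp.add_apply]
  | single q f =>
    obtain ⟨a, e⟩ := p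
    obtain ⟨a', e'⟩ := q
    rw [assemble_single, map_mul, map_mul, matrixRep_untwist_φ', Pi.smul_apply,
      matrixRep_untwist_lastMonomial, smul_eq_mul, Polynomial.coeff_C_mul, Finsupp.single_apply]
    by_cases he : e' = e
    · simp [he, Polynomial.coeff_X_pow, eq_comm]
    · simp [he]

theorem assemble_injective : Function.Injective (assemble k n) := fun w w' h =>
  Finsupp.ext fun p => by
    rw [← coeff_matrixRep_untwist_assemble, h, coeff_matrixRep_untwist_assemble]

/-- `R_{n+1}` is the direct sum of the `φ'(R_n) x_{n+1}^a ω_{n+1}^e`, for `e ∈ {0, 1}`. -/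
def assembleEquiv (k : Type u) [CommRing k] (n : ℕ) : (ℕ × Fin 2 →₀ R k n) ≃ₗ[k] R k (n + 1) :=
  LinearEquiv.ofBijective (assemble k n) ⟨assemble_injective, assemble_surjective⟩

theorem assembleEquiv_single (p : ℕ × Fin 2) (f : R k n) :
    assembleEquiv k n (Finsupp.single p f) = φ' f * lastMonomial k n p.1 p.2 :=
  assemble_single p f

theorem linearMap_ext_decomposed {M : Type*} [AddCommMonoid M] [Module k M]
    {g h : R k (n + 1) →ₗ[k] M}
    (H : ∀ f a e, g (φ' f * lastMonomial k n a e) = h (φ' f * lastMonomial k n a e)) : g = h := by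
  have : g ∘ₗ (assembleEquiv k n).toLinearMap = h ∘ₗ (assembleEquiv k n).toLinearMap :=
    Finsupp.lhom_ext fun p f => by
      simp only [LinearMap.comp_apply, LinearEquiv.coe_coe, assembleEquiv_single, H]
  exact (LinearEquiv.eq_comp_toLinearMap_iff (e₁₂ := assembleEquiv k n) g h).mp this

theorem s_assemble (j : ℕ) (hj : j + 1 < n) (w : ℕ × Fin 2 →₀ R k n) :
    s j (hj.trans n.lt_succ_self) (assemble k n w) =
      assemble k n (Finsupp.mapRange.linearMap (s j hj).toLinearMap w) := by
  induction w using Finsupp.induction_linear with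
  | zero => simp only [map_zero]
  | add w w' hw hw' => simp only [map_add, hw, hw']
  | single p f =>
    rw [assemble_single, map_mul, s_φ' j hj, s_lastMonomial j hj, Finsupp.mapRange.linearMap_apply,
      Finsupp.mapRange_single, assemble_single]
    rfl

/-- Every invariant is a sum of `φ'(g) x_{n+1}^a ω_{n+1}^e` with `g` invariant. -/
theorem invariants_decomposed {r : R k (n + 1)} (hr : r ∈ invariants k (n + 1)) :
    ∃ w : ℕ × Fin 2 →₀ R k n, (∀ p, w p ∈ invariants k n) ∧
      r = ∑ p ∈ w.support, φ' (w p) * lastMonomial k n p.1 p.2 := by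
  obtain ⟨w, rfl⟩ := assemble_surjective r
  refine ⟨w, fun p j hj => ?_, ?_⟩
  -- Only invariance under `s_j` with `j < n` is used: these act coefficientwise, and coefficients
  -- are unique.
  · have h := s_assemble j hj w
    rw [hr j] at h
    have := DFunLike.congr_fun (assemble_injective h) p
    exact this.symm
  · conv_lhs => rw [← Finsupp.sum_single w, Finsupp.sum, map_sum]
    simp only [assemble_single]

/-! ### Extension of endomorphisms and the homomorphism `φ_n` -/

/-- The extension of an endomorphism of `R_n` to an endomorphism of `R_{n+1}`. -/
def extend (k : Type u) [CommRing k] (n : ℕ) :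
    Module.End k (R k n) →ₐ[k] Module.End k (R k (n + 1)) :=
  ((assembleEquiv k n).conjAlgEquiv k).toAlgHom.comp (AlgHom.ofLinearMap
    { toFun := fun ξ => Finsupp.mapRange.linearMap ξ
      map_add' := fun ξ η => by ext; simp
      map_smul' := fun c ξ => by ext; simp }
    (by ext; simp) (fun ξ η => by ext; simp))

theorem extend_apply (ξ : Module.End k (R k n)) (f : R k n) (a e : ℕ) :
    extend k n ξ (φ' f * lastMonomial k n a e) = φ' (ξ f) * lastMonomial k n a e := by
  by_cases he : e < 2
  · have h := assembleEquiv_single (k := k) (n := n) (a, ⟨e, he⟩)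
    simp only at h
    rw [← h, ← h]
    change assembleEquiv k n (Finsupp.mapRange.linearMap ξ ((assembleEquiv k n).symm
      (assembleEquiv k n _))) = _
    rw [LinearEquiv.symm_apply_apply, Finsupp.mapRange.linearMap_apply, Finsupp.mapRange_single]
  · rw [lastMonomial_eq_zero a (not_lt.mp he), mul_zero, mul_zero, map_zero]

/-- Multiplying `φ'(f) x_{n+1}^{a'} ω_{n+1}^{e'}` from the right by this element multiplies the
coefficient `f` from the right by `parity^[e'] g`, which is again invariant, so `ξ` commutes with
the operation. -/
theorem extend_mul_of_invariant {ξ : Module.End k (R k n)} (hξ : ξ ∈ A k n) (f : R k (n + 1))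
    {g : R k n} (hg : g ∈ invariants k n) (a e : ℕ) :
    extend k n ξ (f * (φ' g * lastMonomial k n a e)) =
      extend k n ξ f * (φ' g * lastMonomial k n a e) := by
  have h : extend k n ξ ∘ₗ LinearMap.mulRight k (φ' g * lastMonomial k n a e) =
      LinearMap.mulRight k (φ' g * lastMonomial k n a e) ∘ₗ extend k n ξ := by
    refine linearMap_ext_decomposed fun f a' e' => ?_
    rw [LinearMap.comp_apply, LinearMap.comp_apply, LinearMap.mulRight_apply,
      LinearMap.mulRight_apply, φ'_mul_lastMonomial_mul, extend_apply, extend_apply,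
      φ'_mul_lastMonomial_mul, hξ f _ (parity_iterate_mem_invariants hg e')]
  exact DFunLike.congr_fun h f

theorem extend_mem_A {ξ : Module.End k (R k n)} (hξ : ξ ∈ A k n) :
    extend k n ξ ∈ A k (n + 1) := by
  intro f r hr
  obtain ⟨w, hw, rfl⟩ := invariants_decomposed hr
  rw [Finset.mul_sum, Finset.mul_sum, map_sum]
  exact Finset.sum_congr rfl fun p _ => extend_mul_of_invariant hξ f (hw p) _ _

/-- The homomorphism `φ_n : A_n → A_{n+1}`. -/
def φ : A k n →ₐ[k] A k (n + 1) :=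
  ((extend k n).comp (A k n).val).codRestrict (A k (n + 1)) fun ξ => extend_mem_A ξ.2

theorem φ_apply (ξ : A k n) (f : R k n) (a e : ℕ) :
    (φ ξ).1 (φ' f * lastMonomial k n a e) = φ' (ξ.1 f) * lastMonomial k n a e :=
  extend_apply ξ.1 f a e

theorem A_ext_decomposed {ξ η : A k (n + 1)} (H : ∀ f a e,
    ξ.1 (φ' f * lastMonomial k n a e) = η.1 (φ' f * lastMonomial k n a e)) : ξ = η :=
  Subtype.ext (linearMap_ext_decomposed H)

theorem φ_toA (f : R k n) : φ (toA f) = toA (φ' f) := A_ext_decomposed fun g a e => by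
  rw [φ_apply, toA_apply, toA_apply, map_mul, mul_assoc]

/-- After multiplication by the regular element `x_j - x_{j+1} = φ'(x_j - x_{j+1})` both sides
become `h - s_j(h)` with `h = φ'(f) x_{n+1}^a ω_{n+1}^e`, because `s_j` commutes with `φ'` and fixes
the monomial. -/
theorem φ_T (j : ℕ) (hj : j + 1 < n) :
    φ (T j hj : A k n) = T j (hj.trans n.lt_succ_self) := A_ext_decomposed fun f a e => by
  refine x_sub_x_cancel j (hj.trans n.lt_succ_self) _ _ ?_
  have h : (T j (hj.trans n.lt_succ_self) : A k (n + 1)).1 (φ' f * lastMonomial k n a e) =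
    demazure j (hj.trans n.lt_succ_self) (φ' f * lastMonomial k n a e) := rfl
  have h' : (T j hj : A k n).1 f = demazure j hj f := rfl
  have hx : (x ⟨j, by omega⟩ - x ⟨j + 1, by omega⟩ : R k (n + 1)) =
      φ' (x ⟨j, by omega⟩ - x ⟨j + 1, hj⟩) := by
    rw [map_sub, φ'_x, φ'_x]; rfl
  rw [h, demazure_spec, φ_apply, h', hx, ← mul_assoc, ← map_mul, demazure_spec, map_mul,
    s_φ' j hj, s_lastMonomial j hj, map_sub, sub_mul]

theorem φ_mem_gradingA {s t : ℤ} {ξ : A k n} (hξ : ξ ∈ gradingA k n s t) :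
    φ ξ ∈ gradingA k (n + 1) s t := by
  intro s' t' f hf
  refine Submodule.span_le (p := (grading k (n + 1) (s' + s) (t' + t)).comap (φ ξ).1).mpr ?_
    (grading_le_decomposed s' t' hf)
  rintro _ ⟨f, a, e, p, q, hp, rfl, rfl, rfl⟩
  change (φ ξ).1 _ ∈ grading k (n + 1) _ _
  rw [φ_apply]
  exact mem_of_bidegree_eq _ (grading_mul (φ'_mem_grading (hξ p q f hp))
    (lastMonomial_mem_grading a e)) (by ring) (by ring)

theorem φ'_injective : Function.Injective (φ' : R k n →ₐ[k] R k (n + 1)) := fun f g h => by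
  refine Finsupp.single_injective ((0, 0) : ℕ × Fin 2) (assemble_injective ?_)
  rw [assemble_single, assemble_single, h]

theorem φ_injective : Function.Injective (φ : A k n →ₐ[k] A k (n + 1)) := fun ξ η h => by
  refine Subtype.ext (LinearMap.ext fun f => φ'_injective ?_)
  have := congrArg (fun ξ : A k (n + 1) => ξ.1 (φ' f * lastMonomial k n 0 0)) h
  simp only [φ_apply] at this
  simpa only [lastMonomial_zero, mul_one] using this

/-! ### The derivations -/

theorem d_lastMonomial (a e : ℕ) :
    d (lastMonomial k n a e) = (a : R k (n + 1)) * lastMonomial k n (a + 1) e := by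
  have hω : ∀ e : ℕ, d (ω (Fin.last n) ^ e : R k (n + 1)) = 0 := by
    intro e
    induction e with
    | zero => simpa using d_algebraMap (k := k) (n := n + 1) 1
    | succ e ih => rw [pow_succ, d_mul, ih, d_ω, dω_last, zero_mul, mul_zero, add_zero]
  have hx : d (x (Fin.last n) ^ a : R k (n + 1)) = (a : R k (n + 1)) * x (Fin.last n) ^ (a + 1) := by
    induction a with
    | zero => simpa using d_algebraMap (k := k) (n := n + 1) 1
    | succ a ih =>
      rw [pow_succ, d_mul, ih, d_x, Nat.cast_succ, add_mul, one_mul, mul_assoc, ← pow_succ,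
        ← pow_add]
  rw [lastMonomial, d_mul, hx, hω, mul_zero, add_zero, mul_assoc, lastMonomial]

theorem sum_x_mem_invariants : (∑ i, x i : R k n) ∈ invariants k n := fun j hj => by
  rw [map_sum]
  simp only [s_x]
  exact Equiv.sum_comp (swap j hj) _

/-- The parameters for `n` and `n + 1` are chosen independently; the shift `b` measures the
discrepancy, which contributes a multiple of `∑ x_i` to `D`. -/
theorem exists_sub_eq_of_common_difference (a : k) (c : Fin n → k) (c' : Fin (n + 1) → k)
    (hc : ∀ i j : Fin n, i.val + 1 = j.val → c j - c i = a)
    (hc' : ∀ i j : Fin (n + 1), i.val + 1 = j.val → c' j - c' i = a) :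
    ∃ b, ∀ i : Fin n, c' i.castSucc = c i + b := by
  cases n with
  | zero => exact ⟨0, fun i => i.elim0⟩
  | succ n =>
    refine ⟨c' 0 - c 0, fun i => ?_⟩
    induction i using Fin.induction with
    | zero => simp
    | succ i ih =>
      have h1 := hc i.castSucc i.succ (by simp)
      have h2 := hc' i.castSucc.castSucc i.succ.castSucc (by simp)
      linear_combination ih + h2 - h1

theorem dTwist_apply (c : Fin n → k) (f : R k n) :
    dTwist c f = d f + f * ∑ i, c i • x i := rfl

theorem dA_apply (c : Fin n → k) (ξ : A k n) (f : R k n) :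
    (dA c ξ).1 f = dTwist c (ξ.1 f) - ξ.1 (dTwist c f) := rfl

/-- The last summand collects `d(x_{n+1}^a) = a x_{n+1}^{a+1}`, where `d(ω_{n+1}) = 0` is used, and
the term `c'_{n+1} x_{n+1}` of the twist. -/
theorem dTwist_φ'_mul (c : Fin n → k) (c' : Fin (n + 1) → k) (b : k)
    (hb : ∀ i : Fin n, c' i.castSucc = c i + b) (f : R k n) (a e : ℕ) :
    dTwist c' (φ' f * lastMonomial k n a e) =
      φ' (dTwist c f) * lastMonomial k n a e +
        φ' (b • (f * ∑ i, x i)) * lastMonomial k n a e +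
        ((a : k) + c' (Fin.last n)) • (φ' f * lastMonomial k n (a + 1) e) := by
  have hsum : (∑ i, c' i • x i : R k (n + 1)) = φ' (∑ i, c i • x i) + φ' (b • ∑ i, x i) +
      c' (Fin.last n) • x (Fin.last n) := by
    rw [Fin.sum_univ_castSucc]
    simp only [hb, map_sum, map_smul, φ'_x, add_smul, Finset.sum_add_distrib, Finset.smul_sum]
  have hcomm : ∀ g : R k (n + 1), g * ∑ i, c' i • x i = (∑ i, c' i • x i) * g := fun g => by
    have : (∑ i, c' i • x i : R k (n + 1)) = pol (∑ i, c' i • MvPolynomial.X i) := by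
      simp only [map_sum, map_smul, x]
    rw [this]; exact (pol_comm _ _).symm
  have hlast : x (Fin.last n) * lastMonomial k n a e = lastMonomial k n (a + 1) e := by
    rw [lastMonomial, lastMonomial, ← mul_assoc, ← pow_succ']
  rw [dTwist_apply, d_mul, ← φ'_d, d_lastMonomial, mul_assoc, hcomm, hsum, dTwist_apply, map_add,
    map_mul, map_smul, map_smul, map_mul]
  simp only [add_mul, mul_add, add_smul, smul_mul_assoc, mul_smul_comm, mul_assoc, hlast]
  rw [Nat.cast_smul_eq_nsmul, ← nsmul_eq_mul, mul_smul_comm]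
  abel

theorem φ_dA (a : k) (c : Fin n → k) (c' : Fin (n + 1) → k)
    (hc : ∀ i j : Fin n, i.val + 1 = j.val → c j - c i = a)
    (hc' : ∀ i j : Fin (n + 1), i.val + 1 = j.val → c' j - c' i = a) (ξ : A k n) :
    φ (dA c ξ) = dA c' (φ ξ) := by
  obtain ⟨b, hb⟩ := exists_sub_eq_of_common_difference a c c' hc hc'
  refine A_ext_decomposed fun f m e => ?_
  -- In the commutator with `φ ξ` the last two summands of `dTwist_φ'_mul` drop out: `ξ` is linear
  -- over the invariant `∑ x_i`, and `φ ξ` does not affect the power of `x_{n+1}`.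
  rw [φ_apply, dA_apply, dA_apply, φ_apply, dTwist_φ'_mul c c' b hb, dTwist_φ'_mul c c' b hb,
    map_add, map_add, map_smul (φ ξ).1, φ_apply, φ_apply, φ_apply, map_smul ξ.1,
    ξ.2 f _ sum_x_mem_invariants, map_sub, sub_mul]
  abel

end

end EnhancedNilHecke

open EnhancedNilHecke in
theorem proposition2p23 {k : Type*} [CommRing k] (n : ℕ) :
    ∃ (φ' : R k n →ₐ[k] R k (n + 1)) (φ : A k n →ₐ[k] A k (n + 1)),
      -- the homomorphism `φ'_n : R_n → R_{n+1}`
      (∀ i, φ' (x i) = x i.castSucc) ∧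
      (∀ i, φ' (ω i) = φω i) ∧
      (∀ s t, ∀ f ∈ grading k n s t, φ' f ∈ grading k (n + 1) s t) ∧
      (∀ f, φ' (d f) = d (φ' f)) ∧
      -- the homomorphism `φ_n : A_n → A_{n+1}`
      (∀ i, φ (toA (x i)) = toA (x i.castSucc)) ∧
      (∀ i, φ (toA (ω i)) = toA (φω i)) ∧
      (∀ j (hj : j + 1 < n), φ (T j hj) = T j (hj.trans n.lt_succ_self)) ∧
      (∀ s t, ∀ ξ ∈ gradingA k n s t, φ ξ ∈ gradingA k (n + 1) s t) ∧
      Function.Injective φ ∧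
      (∀ (a : k) (c : Fin n → k) (c' : Fin (n + 1) → k),
        (∀ i j : Fin n, i.val + 1 = j.val → c j - c i = a) →
        (∀ i j : Fin (n + 1), i.val + 1 = j.val → c' j - c' i = a) →
        ∀ ξ, φ (dA c ξ) = dA c' (φ ξ)) ∧
      -- `φ'_n` is the restriction of `φ_n` to the subalgebra `R_n` of `A_n`
      (∀ f, φ (toA f) = toA (φ' f)) :=
  ⟨φ', φ, φ'_x, φ'_ω, fun _ _ _ => φ'_mem_grading, φ'_d,
    fun i => by rw [φ_toA, φ'_x], fun i => by rw [φ_toA, φ'_ω], φ_T,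
    fun _ _ _ => φ_mem_gradingA, φ_injective, φ_dA, φ_toA⟩
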